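/- Let $A_0B_0C_0$ be a non-degenerate triangle in the Euclidean plane. Given the triangle $A_nB_nC_n$, choose points $A_{n+1}$, $B_{n+1}$, $C_{n+1}$ on its sides $B_nC_n$, $C_nA_n$, $A_nB_n$ respectively, uniformly distributed on these sides, independently of each other and of all earlier choices; that is, $$A_{n+1}=B_n+\xi^{(n)}_a(C_n-B_n),\quad B_{n+1}=C_n+\xi^{(n)}_b(A_n-C_n),\quad C_{n+1}=A_n+\xi^{(n)}_c(B_n-A_n),$$ where the variables $\xi^{(n)}_a,\xi^{(n)}_b,\xi^{(n)}_c$ ($n\ge 0$) are independent and uniformly distributed on $[0,1]$. Then almost surely all triangles $A_nB_nC_n$ are non-degenerate, and almost surely the largest angle of $A_nB_nC_n$ converges to $\pi$ as $n\to\infty$. Moreover, let $y_n$ be the ratio of the height of $A_nB_nC_n$ corresponding to its largest side to the length of this side. Then for every real $c<1+\frac{\log 4}{3}-\frac{\pi^2}{9}=0.365\dots$, almost surely $$y_n\le e^{-cn}\quad\text{for all sufficiently large } n.$$ -/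

import Mathlib

namespace RandomTriangle

/-- The Euclidean plane. -/
abbrev Plane : Type := EuclideanSpace ℝ (Fin 2)

/-- A (possibly degenerate) triangle, given by its three vertices `A = T 0`, `B = T 1`, `C = T 2`.
The side opposite to `T i` joins `T (i + 1)` and `T (i + 2)` (indices modulo 3). -/
abbrev Tri : Type := Fin 3 → Plane

/-- The length of the side opposite to the vertex `T i`. -/
noncomputable def side (T : Tri) (i : Fin 3) : ℝ :=
  dist (T (i + 1)) (T (i + 2))

/-- The height of the triangle from the vertex `T i`: the distance from this vertex to the line
through the other two vertices. -/
noncomputable def height (T : Tri) (i : Fin 3) : ℝ :=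
  Metric.infDist (T i) (affineSpan ℝ {T (i + 1), T (i + 2)} : Set Plane)

/-- The side opposite to `T i` is a largest side of the triangle. -/
def IsLargestSide (T : Tri) (i : Fin 3) : Prop :=
  ∀ j, side T j ≤ side T i

/-- The largest of the three angles of the triangle. -/
noncomputable def maxAngle (T : Tri) : ℝ :=
  ⨆ i : Fin 3, EuclideanGeometry.angle (T (i + 1)) (T i) (T (i + 2))

/-- The triangle whose `i`-th vertex lies on the side opposite to `T i` and divides it,
starting from `T (i + 1)`, in the proportion `t i : 1 - t i`. -/
noncomputable def subTriangle (T : Tri) (t : Fin 3 → ℝ) : Tri := fun i =>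
  AffineMap.lineMap (T (i + 1)) (T (i + 2)) (t i)

/-- The sequence of triangles that starts with `T₀`, where the `(n + 1)`-st triangle is inscribed in
the `n`-th one with the parameters `t n`. -/
noncomputable def triangleSeq (T₀ : Tri) (t : ℕ → Fin 3 → ℝ) : ℕ → Tri
  | 0 => T₀
  | n + 1 => subTriangle (triangleSeq T₀ t n) (t n)

end RandomTriangle

open MeasureTheory Set Filter
open scoped ENNReal
open RandomTriangle (Plane Tri side height IsLargestSide maxAngle subTriangle triangleSeq)

/-- The mean of `f` over the segment from `x` to `y`. -/
noncomputable def segMean (x y : ℝ) (f : ℝ → ℝ≥0∞) : ℝ≥0∞ :=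
  ∫⁻ t in Ioo (0 : ℝ) 1, f (x + t * (y - x))

lemma segMean_symm (x y : ℝ) (f : ℝ → ℝ≥0∞) : segMean x y f = segMean y x f := by
  have h := lintegral_image_eq_lintegral_abs_deriv_mul (s := Ioo (0 : ℝ) 1) (f := fun t => 1 - t)
    (f' := fun _ => -1) measurableSet_Ioo
    (fun t _ => by simpa using ((hasDerivAt_id t).const_sub 1).hasDerivWithinAt)
    (fun a _ b _ hab => by simpa using hab) (fun t => f (x + t * (y - x)))
  have himg : (fun t : ℝ => 1 - t) '' Ioo 0 1 = Ioo 0 1 := by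
    simp [image_const_sub_Ioo]
  rw [himg] at h
  rw [segMean, h, segMean]
  refine lintegral_congr fun t => ?_
  simp only [abs_neg, abs_one, ENNReal.ofReal_one, one_mul]
  congr 1; ring

lemma segMean_eq {x y : ℝ} (h : x < y) (f : ℝ → ℝ≥0∞) :
    segMean x y f = ENNReal.ofReal (y - x)⁻¹ * ∫⁻ p in Ioo x y, f p := by
  have hd : 0 < y - x := sub_pos.2 h
  have h := lintegral_image_eq_lintegral_abs_deriv_mul (s := Ioo (0 : ℝ) 1)
    (f := fun t => t * (y - x) + x)
    (f' := fun _ => y - x) measurableSet_Ioo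
    (fun t _ => by simpa using (((hasDerivAt_id t).mul_const (y - x)).add_const x).hasDerivWithinAt)
    (fun a _ b _ hab => by simpa [hd.ne'] using hab) f
  have himg : (fun t : ℝ => t * (y - x) + x) '' Ioo 0 1 = Ioo x y := by
    rw [show (fun t : ℝ => t * (y - x) + x) = fun t => (y - x) * t + x by ext; ring,
      image_affine_Ioo hd]
    simp
  rw [himg] at h
  rw [h, lintegral_const_mul' _ _ ENNReal.ofReal_ne_top, abs_of_pos hd, ← mul_assoc,
    ← ENNReal.ofReal_mul (inv_nonneg.2 hd.le), inv_mul_cancel₀ hd.ne', ENNReal.ofReal_one, one_mul,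
    segMean]
  simp only [add_comm]

lemma segMean_swap (x y z w : ℝ) {H : ℝ → ℝ → ℝ≥0∞} (hH : Measurable (Function.uncurry H)) :
    segMean x y (fun p => segMean z w fun q => H p q) =
      segMean z w fun q => segMean x y fun p => H p q := by
  unfold segMean
  refine lintegral_lintegral_swap ?_
  exact (hH.comp (f := fun p : ℝ × ℝ => (x + p.1 * (y - x), z + p.2 * (w - z)))
    (by fun_prop)).aemeasurable

/-- Functions of three real variables that do not depend on the order of their arguments. -/
structure IsSymm3 (F : ℝ → ℝ → ℝ → ℝ≥0∞) : Prop where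
  swap12 : ∀ x y z, F x y z = F y x z
  swap23 : ∀ x y z, F x y z = F x z y

lemma IsSymm3.swap13 {F : ℝ → ℝ → ℝ → ℝ≥0∞} (hF : IsSymm3 F) (x y z : ℝ) :
    F x y z = F z y x := by
  rw [hF.swap12, hF.swap23, hF.swap12]

/-- The mean of `F` over three points, each uniformly distributed on a segment joining
two of the points `x`, `y`, `z`. -/
noncomputable def nextMean (F : ℝ → ℝ → ℝ → ℝ≥0∞) (x y z : ℝ) : ℝ≥0∞ :=
  segMean y z fun p => segMean z x fun q => segMean x y fun r => F p q r

lemma measurable_segMean {α : Type*} [MeasurableSpace α] (x y : ℝ) {H : α → ℝ → ℝ≥0∞}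
    (hH : Measurable (Function.uncurry H)) : Measurable fun a => segMean x y (H a) := by
  unfold segMean
  refine Measurable.lintegral_prod_right' (f := fun p : α × ℝ => H p.1 (x + p.2 * (y - x))) ?_
  exact hH.comp (f := fun p : α × ℝ => (p.1, x + p.2 * (y - x))) (by fun_prop)

section

variable {F : ℝ → ℝ → ℝ → ℝ≥0∞}

lemma nextMean_swap12 (hF : IsSymm3 F) (hm : Measurable fun p : ℝ × ℝ × ℝ => F p.1 p.2.1 p.2.2)
    (x y z : ℝ) : nextMean F x y z = nextMean F y x z := by
  unfold nextMean
  rw [segMean_swap]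
  · rw [segMean_symm z x]
    congr 1; ext q
    rw [segMean_symm y z]
    congr 1; ext p
    rw [segMean_symm x y]
    congr 1; ext r
    exact hF.swap12 _ _ _
  · exact measurable_segMean (α := ℝ × ℝ) x y (H := fun a r => F a.1 a.2 r)
      (hm.comp (f := fun p : (ℝ × ℝ) × ℝ => (p.1.1, p.1.2, p.2)) (by fun_prop))

lemma nextMean_swap23 (hF : IsSymm3 F) (hm : Measurable fun p : ℝ × ℝ × ℝ => F p.1 p.2.1 p.2.2)
    (x y z : ℝ) : nextMean F x y z = nextMean F x z y := by
  unfold nextMean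
  rw [segMean_symm y z]
  congr 1; ext p
  rw [segMean_swap]
  · rw [segMean_symm x y]
    congr 1; ext q
    rw [segMean_symm x z]
    congr 1; ext r
    exact hF.swap23 _ _ _
  · exact hm.comp (f := fun a : ℝ × ℝ => (p, a.1, a.2)) (by fun_prop)

/-- Tonelli's theorem on a triangle. -/
lemma lintegral_triangle_swap (l m : ℝ) {H : ℝ → ℝ → ℝ≥0∞}
    (hH : Measurable (Function.uncurry H)) :
    ∫⁻ a in Ioo l m, ∫⁻ e in Ioo l a, H a e = ∫⁻ e in Ioo l m, ∫⁻ a in Ioo e m, H a e := by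
  have e1 : ∀ a ∈ Ioo l m, ∫⁻ e in Ioo l a, H a e =
      ∫⁻ e in Ioo l m, {p : ℝ × ℝ | p.2 < p.1}.indicator (Function.uncurry H) (a, e) := by
    intro a ha
    have : (fun e => {p : ℝ × ℝ | p.2 < p.1}.indicator (Function.uncurry H) (a, e)) =
        (Iio a).indicator (H a) := by
      ext e; simp [indicator, Function.uncurry]
    rw [this, setLIntegral_indicator measurableSet_Iio]
    congr 2
    ext e; simp only [mem_Ioo, mem_inter_iff, mem_Iio] at *; constructor
    · rintro ⟨h1, h2⟩; exact ⟨h2, h1, h2.trans ha.2⟩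
    · rintro ⟨h1, h2, _⟩; exact ⟨h2, h1⟩
  have e2 : ∀ e ∈ Ioo l m, ∫⁻ a in Ioo e m, H a e =
      ∫⁻ a in Ioo l m, {p : ℝ × ℝ | p.2 < p.1}.indicator (Function.uncurry H) (a, e) := by
    intro e he
    have : (fun a => {p : ℝ × ℝ | p.2 < p.1}.indicator (Function.uncurry H) (a, e)) =
        (Ioi e).indicator (fun a => H a e) := by
      ext a; simp [indicator, Function.uncurry]
    rw [this, setLIntegral_indicator measurableSet_Ioi]
    congr 2
    ext a; simp only [mem_Ioo, mem_inter_iff, mem_Ioi] at *; constructor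
    · rintro ⟨h1, h2⟩; exact ⟨h1, he.1.trans h1, h2⟩
    · rintro ⟨h1, h2, h3⟩; exact ⟨h1, h3⟩
  rw [setLIntegral_congr_fun measurableSet_Ioo e1, setLIntegral_congr_fun measurableSet_Ioo e2]
  refine lintegral_lintegral_swap ?_
  exact (hH.indicator (measurableSet_lt measurable_snd measurable_fst)).aemeasurable

lemma setLIntegral_Ioo_split {a b c : ℝ} (hab : a < b) (hbc : b < c) (f : ℝ → ℝ≥0∞) :
    ∫⁻ e in Ioo a c, f e = (∫⁻ e in Ioo a b, f e) + ∫⁻ e in Ioo b c, f e := by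
  rw [← Ioo_union_Ico_eq_Ioo hab hbc.le, lintegral_union measurableSet_Ico]
  · rw [Measure.restrict_congr_set (Ioo_ae_eq_Ico (a := b) (b := c) (μ := volume)).symm]
  · rw [Set.disjoint_left]
    rintro x ⟨_, h1⟩ ⟨h2, _⟩
    exact absurd h1 (not_lt.2 h2)

lemma measurable_setLIntegral_Ioo {α : Type*} [MeasurableSpace α] {u v : α → ℝ} (hu : Measurable u)
    (hv : Measurable v) {H : α → ℝ → ℝ≥0∞} (hH : Measurable (Function.uncurry H)) :
    Measurable fun a => ∫⁻ e in Ioo (u a) (v a), H a e := by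
  have : ∀ a, ∫⁻ e in Ioo (u a) (v a), H a e =
      ∫⁻ e, {p : α × ℝ | u p.1 < p.2 ∧ p.2 < v p.1}.indicator (Function.uncurry H) (a, e) := by
    intro a
    rw [← lintegral_indicator measurableSet_Ioo]
    refine lintegral_congr fun e => ?_
    simp [indicator, Function.uncurry]
  simp only [this]
  refine Measurable.lintegral_prod_right' (hH.indicator ?_)
  exact (measurableSet_lt (hu.comp measurable_fst) measurable_snd).inter
    (measurableSet_lt measurable_snd (hv.comp measurable_fst))

/-- The order statistics of the next triple: given the smallest and the largest value, the
middle one is uniform between them. -/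
lemma nextMean_of_lt (hF : IsSymm3 F) (hm : Measurable fun p : ℝ × ℝ × ℝ => F p.1 p.2.1 p.2.2)
    {l m h : ℝ} (hlm : l < m) (hmh : m < h) :
    nextMean F l m h = ENNReal.ofReal (2 / ((m - l) * (h - m) * (h - l))) *
      ∫⁻ a in Ioo l m, ∫⁻ b in Ioo m h, ∫⁻ e in Ioo a b, F a e b := by
  have hlh := hlm.trans hmh
  have h1 : 0 < m - l := sub_pos.2 hlm
  have h2 : 0 < h - m := sub_pos.2 hmh
  have h3 : 0 < h - l := sub_pos.2 hlh
  have meas : ∀ {α : Type} [MeasurableSpace α] {x y z : α → ℝ}, Measurable x → Measurable y →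
      Measurable z → Measurable fun a => F (x a) (y a) (z a) := fun hx hy hz =>
    hm.comp (hx.prodMk (hy.prodMk hz))
  have hM : ∀ (l m : ℝ → ℝ), Measurable l → Measurable m → Measurable fun p : ℝ × ℝ =>
      ∫⁻ b in Ioo (l p.1) (m p.2), F p.1 b p.2 := by
    intro l m hl hm
    exact measurable_setLIntegral_Ioo (by fun_prop) (by fun_prop)
      (meas (by fun_prop) (by fun_prop) (by fun_prop))
  -- rewrite as an integral over the smallest segment, the largest segment and the whole one
  have step1 : nextMean F l m h =
      ENNReal.ofReal (m - l)⁻¹ * (ENNReal.ofReal (h - m)⁻¹ * (ENNReal.ofReal (h - l)⁻¹ *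
        ∫⁻ a in Ioo l m, ∫⁻ b in Ioo m h, ∫⁻ e in Ioo l h, F a e b)) := by
    have : nextMean F l m h = segMean l m fun a => segMean m h fun b => segMean l h fun e =>
        F a e b := by
      unfold nextMean
      have : ∀ p, (segMean h l fun q => segMean l m fun r => F p q r) =
          segMean l m fun r => segMean h l fun q => F p q r := fun p =>
        segMean_swap _ _ _ _ (meas (by fun_prop) (by fun_prop) (by fun_prop))
      simp only [this]
      rw [segMean_swap]
      · congr 1; ext a; congr 1; ext b
        rw [segMean_symm]
        congr 1; ext e
        exact hF.swap13 _ _ _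
      · exact measurable_segMean (α := ℝ × ℝ) h l (H := fun p q => F p.1 q p.2)
          (meas (by fun_prop) (by fun_prop) (by fun_prop))
    rw [this, segMean_eq hlm]
    simp only [segMean_eq hmh, segMean_eq hlh]
    congr 1
    rw [← lintegral_const_mul' _ _ ENNReal.ofReal_ne_top,
      ← lintegral_const_mul' _ _ ENNReal.ofReal_ne_top]
    refine lintegral_congr fun a => ?_
    rw [lintegral_const_mul' _ _ ENNReal.ofReal_ne_top]
  have first : ∫⁻ a in Ioo l m, ∫⁻ b in Ioo m h, ∫⁻ e in Ioo l a, F a e b =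
      ∫⁻ a in Ioo l m, ∫⁻ b in Ioo m h, ∫⁻ e in Ioo a m, F a e b := by
    have s1 : ∀ a, ∫⁻ b in Ioo m h, ∫⁻ e in Ioo l a, F a e b =
        ∫⁻ e in Ioo l a, ∫⁻ b in Ioo m h, F a e b := fun a =>
      lintegral_lintegral_swap (meas (by fun_prop) (by fun_prop) (by fun_prop)).aemeasurable
    have s2 : ∀ a, ∫⁻ b in Ioo m h, ∫⁻ e in Ioo a m, F a e b =
        ∫⁻ e in Ioo a m, ∫⁻ b in Ioo m h, F a e b := fun a =>
      lintegral_lintegral_swap (meas (by fun_prop) (by fun_prop) (by fun_prop)).aemeasurable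
    simp only [s1, s2]
    rw [lintegral_triangle_swap l m (H := fun a e => ∫⁻ b in Ioo m h, F a e b)]
    · simp only [hF.swap12]
    · exact measurable_setLIntegral_Ioo (α := ℝ × ℝ) (u := fun _ => m) (v := fun _ => h)
        (H := fun p b => F p.1 p.2 b) (by fun_prop) (by fun_prop)
        (meas (by fun_prop) (by fun_prop) (by fun_prop))
  have second : ∀ a, ∫⁻ b in Ioo m h, ∫⁻ e in Ioo b h, F a e b =
      ∫⁻ b in Ioo m h, ∫⁻ e in Ioo m b, F a e b := fun a => by
    rw [lintegral_triangle_swap m h (H := fun b e => F a e b)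
      (meas (by fun_prop) (by fun_prop) (by fun_prop))]
    simp only [hF.swap23 a]
  have ae_restrict : ∀ (s t : ℝ) (f g : ℝ → ℝ≥0∞), (∀ x ∈ Ioo s t, f x = g x) →
      ∫⁻ x in Ioo s t, f x = ∫⁻ x in Ioo s t, g x := fun s t f g hfg =>
    setLIntegral_congr_fun measurableSet_Ioo hfg
  have split : ∫⁻ a in Ioo l m, ∫⁻ b in Ioo m h, ∫⁻ e in Ioo l h, F a e b =
      2 * ∫⁻ a in Ioo l m, ∫⁻ b in Ioo m h, ∫⁻ e in Ioo a b, F a e b := by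
    have mm : ∀ (u v : ℝ × ℝ → ℝ), Measurable u → Measurable v → Measurable fun p : ℝ × ℝ =>
        ∫⁻ e in Ioo (u p) (v p), F p.1 e p.2 := fun u v hu hv =>
      measurable_setLIntegral_Ioo hu hv (meas (by fun_prop) (by fun_prop) (by fun_prop))
    have mm1 : ∀ (u v : ℝ × ℝ → ℝ), Measurable u → Measurable v → ∀ a, Measurable fun b : ℝ =>
        ∫⁻ e in Ioo (u (a, b)) (v (a, b)), F a e b := fun u v hu hv a =>
      (mm u v hu hv).comp (f := fun b : ℝ => (a, b)) (by fun_prop)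
    have mm2 : ∀ (u v : ℝ × ℝ → ℝ), Measurable u → Measurable v → Measurable fun a : ℝ =>
        ∫⁻ b in Ioo m h, ∫⁻ e in Ioo (u (a, b)) (v (a, b)), F a e b := fun u v hu hv =>
      measurable_setLIntegral_Ioo (u := fun _ => m) (v := fun _ => h)
        (by fun_prop) (by fun_prop) (mm u v hu hv)
    have d1 : ∫⁻ a in Ioo l m, ∫⁻ b in Ioo m h, ∫⁻ e in Ioo l h, F a e b =
        ∫⁻ a in Ioo l m, ((∫⁻ b in Ioo m h, ∫⁻ e in Ioo l a, F a e b) +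
          ((∫⁻ b in Ioo m h, ∫⁻ e in Ioo a b, F a e b) +
          ∫⁻ b in Ioo m h, ∫⁻ e in Ioo b h, F a e b)) := by
      refine ae_restrict _ _ _ _ fun a ha => ?_
      rw [← lintegral_add_left (mm1 (fun p => p.1) (fun p => p.2) (by fun_prop) (by fun_prop) a),
        ← lintegral_add_left (mm1 (fun p => l) (fun p => p.1) (by fun_prop) (by fun_prop) a)]
      refine ae_restrict _ _ _ _ fun b hb => ?_
      rw [setLIntegral_Ioo_split ha.1 (ha.2.trans (hb.1.trans hb.2)),
        setLIntegral_Ioo_split (ha.2.trans hb.1) hb.2]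
    have d2 : ∫⁻ a in Ioo l m, ∫⁻ b in Ioo m h, ∫⁻ e in Ioo a b, F a e b =
        ∫⁻ a in Ioo l m, ((∫⁻ b in Ioo m h, ∫⁻ e in Ioo a m, F a e b) +
          ∫⁻ b in Ioo m h, ∫⁻ e in Ioo m b, F a e b) := by
      refine ae_restrict _ _ _ _ fun a ha => ?_
      rw [← lintegral_add_left (mm1 (fun p => p.1) (fun p => m) (by fun_prop) (by fun_prop) a)]
      refine ae_restrict _ _ _ _ fun b hb => ?_
      rw [setLIntegral_Ioo_split ha.2 hb.1]
    rw [d1, lintegral_add_left (mm2 (fun p => l) (fun p => p.1) (by fun_prop) (by fun_prop)),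
      lintegral_add_left (mm2 (fun p => p.1) (fun p => p.2) (by fun_prop) (by fun_prop)), first]
    simp only [second]
    rw [two_mul]
    nth_rewrite 3 [d2]
    rw [lintegral_add_left (mm2 (fun p => p.1) (fun p => m) (by fun_prop) (by fun_prop))]
    ring
  rw [step1, split]
  have hc : ENNReal.ofReal (2 / ((m - l) * (h - m) * (h - l))) = ENNReal.ofReal (m - l)⁻¹ *
      (ENNReal.ofReal (h - m)⁻¹ * (ENNReal.ofReal (h - l)⁻¹ * 2)) := by
    rw [show (2 : ℝ≥0∞) = ENNReal.ofReal 2 by simp, ← ENNReal.ofReal_mul (by positivity),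
      ← ENNReal.ofReal_mul (by positivity), ← ENNReal.ofReal_mul (by positivity)]
    congr 1; field_simp
  rw [hc]
  ring

end

lemma setLIntegral_Ioo_ofReal {a b : ℝ} (hab : a ≤ b) {f : ℝ → ℝ} (hf : Continuous f)
    (h0 : ∀ x ∈ Ioo a b, 0 ≤ f x) :
    ∫⁻ x in Ioo a b, ENNReal.ofReal (f x) = ENNReal.ofReal (∫ x in a..b, f x) := by
  rw [intervalIntegral.integral_of_le hab, integral_Ioc_eq_integral_Ioo,
    ofReal_integral_eq_lintegral_ofReal]
  · exact (hf.integrableOn_Icc (a := a) (b := b)).mono_set Ioo_subset_Icc_self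
  · exact (ae_restrict_iff' measurableSet_Ioo).2 (Filter.Eventually.of_forall h0)

lemma integral_sub_pow_sub_pow (l m h : ℝ) (k : ℕ) :
    ∫ a in l..m, ∫ b in m..h, (b - a) ^ k =
      ((h - l) ^ (k + 2) - (m - l) ^ (k + 2) - (h - m) ^ (k + 2)) / ((k + 1) * (k + 2)) := by
  have h1 : ∀ a : ℝ, ∫ b in m..h, (b - a) ^ k =
      ((h - a) ^ (k + 1) - (m - a) ^ (k + 1)) / (k + 1) := fun a => by
    rw [intervalIntegral.integral_comp_sub_right (fun x => x ^ k), integral_pow]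
  have h2 : ∀ c : ℝ, ∫ a in l..m, (c - a) ^ (k + 1) =
      ((c - l) ^ (k + 2) - (c - m) ^ (k + 2)) / (k + 2) := fun c => by
    rw [intervalIntegral.integral_comp_sub_left (fun x => x ^ (k + 1)), integral_pow]
    push_cast; ring
  simp only [h1]
  rw [intervalIntegral.integral_div, intervalIntegral.integral_sub, h2, h2]
  · rw [sub_self, zero_pow (by omega)]
    have : (k : ℝ) + 1 ≠ 0 := by positivity
    have : (k : ℝ) + 2 ≠ 0 := by positivity
    field_simp
    ring
  · exact Continuous.intervalIntegrable (by fun_prop) _ _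
  · exact Continuous.intervalIntegrable (by fun_prop) _ _

lemma setLIntegral_ofReal_sub_pow {l m h : ℝ} (hlm : l < m) (hmh : m < h) {C : ℝ} (hC : 0 ≤ C)
    (k : ℕ) : ∫⁻ a in Ioo l m, ∫⁻ b in Ioo m h, ENNReal.ofReal (C * (b - a) ^ k) =
      ENNReal.ofReal (C * (((h - l) ^ (k + 2) - (m - l) ^ (k + 2) - (h - m) ^ (k + 2)) /
        ((k + 1) * (k + 2)))) := by
  have e : ∀ a ∈ Ioo l m, ∫⁻ b in Ioo m h, ENNReal.ofReal (C * (b - a) ^ k) =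
      ENNReal.ofReal (C * ∫ b in m..h, (b - a) ^ k) := fun a ha => by
    rw [setLIntegral_Ioo_ofReal hmh.le (by fun_prop), intervalIntegral.integral_const_mul]
    exact fun b hb => mul_nonneg hC (pow_nonneg (by linarith [ha.2, hb.1]) _)
  rw [setLIntegral_congr_fun measurableSet_Ioo e, setLIntegral_Ioo_ofReal hlm.le,
    intervalIntegral.integral_const_mul, integral_sub_pow_sub_pow]
  · refine continuous_const.mul ?_
    simp only [intervalIntegral.integral_comp_sub_right (fun x => x ^ k), integral_pow]
    fun_prop
  · intro a ha
    refine mul_nonneg hC (intervalIntegral.integral_nonneg hmh.le fun b hb => ?_)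
    exact pow_nonneg (by linarith [ha.2, hb.1]) _

section

variable {F : ℝ → ℝ → ℝ → ℝ≥0∞}

lemma nextMean_eq_of_pow (hF : IsSymm3 F)
    (hm : Measurable fun p : ℝ × ℝ × ℝ => F p.1 p.2.1 p.2.2)
    {l m h : ℝ} (hlm : l < m) (hmh : m < h) {C : ℝ} (hC : 0 ≤ C) (k : ℕ)
    (hk : ∀ a b, a < b → ∫⁻ e in Ioo a b, F a e b = ENNReal.ofReal (C * (b - a) ^ k)) :
    nextMean F l m h = ENNReal.ofReal (2 / ((m - l) * (h - m) * (h - l)) * (C *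
      (((h - l) ^ (k + 2) - (m - l) ^ (k + 2) - (h - m) ^ (k + 2)) / ((k + 1) * (k + 2))))) := by
  have h1 : 0 < m - l := sub_pos.2 hlm
  have h2 : 0 < h - m := sub_pos.2 hmh
  have h3 : 0 < h - l := sub_pos.2 (hlm.trans hmh)
  rw [nextMean_of_lt hF hm hlm hmh, ENNReal.ofReal_mul (by positivity),
    ← setLIntegral_ofReal_sub_pow hlm hmh hC]
  congr 1
  refine setLIntegral_congr_fun measurableSet_Ioo fun a ha =>
    setLIntegral_congr_fun measurableSet_Ioo fun b hb => hk _ _ (ha.2.trans hb.1)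

lemma nextMean_le_of_linear (hF : IsSymm3 F)
    (hm : Measurable fun p : ℝ × ℝ × ℝ => F p.1 p.2.1 p.2.2)
    {l m h : ℝ} (hlm : l < m) (hmh : m < h) {C : ℝ} (hC : 0 ≤ C)
    (hk : ∀ a b, a < b → ∫⁻ e in Ioo a b, F a e b ≤ ENNReal.ofReal (C * (b - a))) :
    nextMean F l m h ≤ ENNReal.ofReal C := by
  have h1 : 0 < m - l := sub_pos.2 hlm
  have h2 : 0 < h - m := sub_pos.2 hmh
  have h3 : 0 < h - l := sub_pos.2 (hlm.trans hmh)
  have e : C = 2 / ((m - l) * (h - m) * (h - l)) * (C *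
      (((h - l) ^ (1 + 2) - (m - l) ^ (1 + 2) - (h - m) ^ (1 + 2)) /
        (((1 : ℕ) + 1) * ((1 : ℕ) + 2)))) := by
    push_cast
    field_simp
    ring
  rw [nextMean_of_lt hF hm hlm hmh]
  conv_rhs => rw [e, ENNReal.ofReal_mul (by positivity),
    ← setLIntegral_ofReal_sub_pow hlm hmh hC]
  refine mul_le_mul' le_rfl (setLIntegral_mono' (measurableSet_Ioo (a := l) (b := m)) fun a ha =>
    setLIntegral_mono' (measurableSet_Ioo (a := m) (b := h)) fun b hb => ?_)
  simpa using hk _ _ (ha.2.trans hb.1)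

end

/-- The length of the smallest interval that contains three reals. -/
noncomputable def spread (x y z : ℝ) : ℝ := (|x - y| + |y - z| + |z - x|) / 2

/-- The product of the two ratios in which the middle one of three reals divides the interval
spanned by the others. -/
noncomputable def balance (x y z : ℝ) : ℝ := |x - y| * |y - z| * |z - x| / spread x y z ^ 3

/-- Three reals are pairwise distinct. -/
def Distinct3 (x y z : ℝ) : Prop := x ≠ y ∧ y ≠ z ∧ z ≠ x

lemma spread_swap12 (x y z : ℝ) : spread x y z = spread y x z := by
  unfold spread; rw [abs_sub_comm x y, abs_sub_comm y z, abs_sub_comm z x]; ring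

lemma spread_swap23 (x y z : ℝ) : spread x y z = spread x z y := by
  unfold spread; rw [abs_sub_comm x y, abs_sub_comm y z, abs_sub_comm z x]; ring

lemma balance_swap12 (x y z : ℝ) : balance x y z = balance y x z := by
  unfold balance
  rw [spread_swap12, abs_sub_comm x y, abs_sub_comm y z, abs_sub_comm z x]; ring

lemma balance_swap23 (x y z : ℝ) : balance x y z = balance x z y := by
  unfold balance
  rw [spread_swap23, abs_sub_comm x y, abs_sub_comm y z, abs_sub_comm z x]; ring

lemma distinct3_swap12 (x y z : ℝ) : Distinct3 x y z ↔ Distinct3 y x z := by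
  unfold Distinct3; tauto

lemma distinct3_swap23 (x y z : ℝ) : Distinct3 x y z ↔ Distinct3 x z y := by
  unfold Distinct3; tauto

lemma isSymm3_of_spread_balance (f : Prop → ℝ → ℝ → ℝ≥0∞) :
    IsSymm3 fun x y z => f (Distinct3 x y z) (spread x y z) (balance x y z) where
  swap12 x y z := by rw [spread_swap12, balance_swap12, propext (distinct3_swap12 x y z)]
  swap23 x y z := by rw [spread_swap23, balance_swap23, propext (distinct3_swap23 x y z)]

lemma spread_of_lt {x y z : ℝ} (hxy : x < y) (hyz : y < z) : spread x y z = z - x := by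
  unfold spread
  rw [abs_of_neg (sub_neg.2 hxy), abs_of_neg (sub_neg.2 hyz),
    abs_of_pos (sub_pos.2 (hxy.trans hyz))]
  ring

lemma balance_of_lt {x y z : ℝ} (hxy : x < y) (hyz : y < z) :
    balance x y z = (y - x) * (z - y) / (z - x) ^ 2 := by
  have := sub_pos.2 (hxy.trans hyz)
  unfold balance
  rw [spread_of_lt hxy hyz, abs_of_neg (sub_neg.2 hxy), abs_of_neg (sub_neg.2 hyz),
    abs_of_pos (sub_pos.2 (hxy.trans hyz))]
  field_simp
  ring

lemma spread_nonneg (x y z : ℝ) : 0 ≤ spread x y z := by unfold spread; positivity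

lemma balance_nonneg (x y z : ℝ) : 0 ≤ balance x y z := by
  have := spread_nonneg x y z
  unfold balance; positivity

lemma Distinct3.spread_pos {x y z : ℝ} (h : Distinct3 x y z) : 0 < spread x y z := by
  have := abs_pos.2 (sub_ne_zero.2 h.1)
  unfold spread; positivity

lemma Distinct3.balance_pos {x y z : ℝ} (h : Distinct3 x y z) : 0 < balance x y z := by
  have h1 := abs_pos.2 (sub_ne_zero.2 h.1)
  have h2 := abs_pos.2 (sub_ne_zero.2 h.2.1)
  have h3 := abs_pos.2 (sub_ne_zero.2 h.2.2)
  have := h.spread_pos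
  unfold balance; positivity

lemma measurable_spread : Measurable fun p : ℝ × ℝ × ℝ => spread p.1 p.2.1 p.2.2 := by
  unfold spread
  exact Continuous.measurable (by fun_prop)

lemma measurable_balance : Measurable fun p : ℝ × ℝ × ℝ => balance p.1 p.2.1 p.2.2 := by
  unfold balance
  exact (Continuous.measurable (by fun_prop)).div (measurable_spread.pow_const 3)

lemma measurableSet_distinct3 : MeasurableSet {p : ℝ × ℝ × ℝ | Distinct3 p.1 p.2.1 p.2.2} := by
  unfold Distinct3
  have h : ∀ f g : ℝ × ℝ × ℝ → ℝ, Measurable f → Measurable g → MeasurableSet {p | f p ≠ g p} :=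
    fun f g hf hg => (measurableSet_eq_fun hf hg).compl
  exact (h _ _ (by fun_prop) (by fun_prop)).inter
    ((h _ _ (by fun_prop) (by fun_prop)).inter (h _ _ (by fun_prop) (by fun_prop)))

lemma spread_le {x y z l h : ℝ} (hx : x ∈ Icc l h) (hy : y ∈ Icc l h) (hz : z ∈ Icc l h) :
    spread x y z ≤ h - l := by
  obtain ⟨_, _⟩ := hx
  obtain ⟨_, _⟩ := hy
  obtain ⟨_, _⟩ := hz
  unfold spread
  rcases abs_cases (x - y) with ⟨e1, _⟩ | ⟨e1, _⟩ <;>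
    rcases abs_cases (y - z) with ⟨e2, _⟩ | ⟨e2, _⟩ <;>
    rcases abs_cases (z - x) with ⟨e3, _⟩ | ⟨e3, _⟩ <;> rw [e1, e2, e3] <;> linarith

/-- Sorting three distinct reals. -/
lemma Distinct3.exists_sorted {x y z : ℝ} (hd : Distinct3 x y z) :
    ∃ l m h, l < m ∧ m < h ∧ spread x y z = h - l ∧
      balance x y z = (m - l) * (h - m) / (h - l) ^ 2 ∧
      (x ∈ Icc l h ∧ y ∈ Icc l h ∧ z ∈ Icc l h) ∧
      ∀ F : ℝ → ℝ → ℝ → ℝ≥0∞, IsSymm3 F →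
        (Measurable fun p : ℝ × ℝ × ℝ => F p.1 p.2.1 p.2.2) →
        nextMean F x y z = nextMean F l m h := by
  have base : ∀ l m h, l < m → m < h → ∃ l' m' h', l' < m' ∧ m' < h' ∧ spread l m h = h' - l' ∧
      balance l m h = (m' - l') * (h' - m') / (h' - l') ^ 2 ∧
      (l ∈ Icc l' h' ∧ m ∈ Icc l' h' ∧ h ∈ Icc l' h') ∧
      ∀ F : ℝ → ℝ → ℝ → ℝ≥0∞, IsSymm3 F →
        (Measurable fun p : ℝ × ℝ × ℝ => F p.1 p.2.1 p.2.2) →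
        nextMean F l m h = nextMean F l' m' h' := fun l m h hlm hmh =>
    ⟨l, m, h, hlm, hmh, spread_of_lt hlm hmh, balance_of_lt hlm hmh,
      ⟨⟨le_rfl, (hlm.trans hmh).le⟩, ⟨hlm.le, hmh.le⟩, ⟨(hlm.trans hmh).le, le_rfl⟩⟩,
      fun _ _ _ => rfl⟩
  have s12 : ∀ x y z : ℝ, (∃ l m h, l < m ∧ m < h ∧ spread y x z = h - l ∧
      balance y x z = (m - l) * (h - m) / (h - l) ^ 2 ∧
      (y ∈ Icc l h ∧ x ∈ Icc l h ∧ z ∈ Icc l h) ∧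
      ∀ F : ℝ → ℝ → ℝ → ℝ≥0∞, IsSymm3 F →
        (Measurable fun p : ℝ × ℝ × ℝ => F p.1 p.2.1 p.2.2) →
        nextMean F y x z = nextMean F l m h) → ∃ l m h, l < m ∧ m < h ∧ spread x y z = h - l ∧
      balance x y z = (m - l) * (h - m) / (h - l) ^ 2 ∧
      (x ∈ Icc l h ∧ y ∈ Icc l h ∧ z ∈ Icc l h) ∧
      ∀ F : ℝ → ℝ → ℝ → ℝ≥0∞, IsSymm3 F →
        (Measurable fun p : ℝ × ℝ × ℝ => F p.1 p.2.1 p.2.2) →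
        nextMean F x y z = nextMean F l m h := by
    rintro x y z ⟨l, m, h, h1, h2, h3, h4, ⟨h5, h6, h7⟩, h8⟩
    exact ⟨l, m, h, h1, h2, by rw [spread_swap12, h3], by rw [balance_swap12, h4], ⟨h6, h5, h7⟩,
      fun F hF hm => by rw [nextMean_swap12 hF hm, h8 F hF hm]⟩
  have s23 : ∀ x y z : ℝ, (∃ l m h, l < m ∧ m < h ∧ spread x z y = h - l ∧
      balance x z y = (m - l) * (h - m) / (h - l) ^ 2 ∧
      (x ∈ Icc l h ∧ z ∈ Icc l h ∧ y ∈ Icc l h) ∧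
      ∀ F : ℝ → ℝ → ℝ → ℝ≥0∞, IsSymm3 F →
        (Measurable fun p : ℝ × ℝ × ℝ => F p.1 p.2.1 p.2.2) →
        nextMean F x z y = nextMean F l m h) → ∃ l m h, l < m ∧ m < h ∧ spread x y z = h - l ∧
      balance x y z = (m - l) * (h - m) / (h - l) ^ 2 ∧
      (x ∈ Icc l h ∧ y ∈ Icc l h ∧ z ∈ Icc l h) ∧
      ∀ F : ℝ → ℝ → ℝ → ℝ≥0∞, IsSymm3 F →
        (Measurable fun p : ℝ × ℝ × ℝ => F p.1 p.2.1 p.2.2) →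
        nextMean F x y z = nextMean F l m h := by
    rintro x y z ⟨l, m, h, h1, h2, h3, h4, ⟨h5, h6, h7⟩, h8⟩
    exact ⟨l, m, h, h1, h2, by rw [spread_swap23, h3], by rw [balance_swap23, h4], ⟨h5, h7, h6⟩,
      fun F hF hm => by rw [nextMean_swap23 hF hm, h8 F hF hm]⟩
  rcases lt_or_gt_of_ne hd.1 with hxy | hxy <;> rcases lt_or_gt_of_ne hd.2.1 with hyz | hyz <;>
    rcases lt_or_gt_of_ne hd.2.2 with hzx | hzx
  · linarith
  · exact base _ _ _ hxy hyz
  · exact s23 _ _ _ (s12 _ _ _ (base _ _ _ hzx hxy))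
  · exact s23 _ _ _ (base _ _ _ hzx hyz)
  · exact s12 _ _ _ (s23 _ _ _ (base _ _ _ hyz hzx))
  · exact s12 _ _ _ (base _ _ _ hxy hzx)
  · exact s12 _ _ _ (s23 _ _ _ (s12 _ _ _ (base _ _ _ hyz hxy)))
  · linarith

section

variable {x y z : ℝ}

lemma Distinct3.balance_le (hd : Distinct3 x y z) : balance x y z ≤ 1 / 4 := by
  obtain ⟨l, m, h, hlm, hmh, -, hb, -⟩ := hd.exists_sorted
  have : 0 < h - l := by linarith
  rw [hb, div_le_iff₀ (by positivity)]
  nlinarith [sq_nonneg (m - l - (h - m))]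

lemma setLIntegral_Ioo_congr_of {a b : ℝ} {f : ℝ → ℝ≥0∞} {c v : ℝ}
    (h : ∀ e, a < e → e < b → f e = ENNReal.ofReal c) (hc : 0 ≤ c)
    (hv : v = c * (b - a)) : ∫⁻ e in Ioo a b, f e = ENNReal.ofReal v := by
  rw [setLIntegral_congr_fun measurableSet_Ioo (fun e he => h e he.1 he.2)]
  rw [setLIntegral_const, Real.volume_Ioo, hv, ENNReal.ofReal_mul hc]

lemma Distinct3.nextMean_inv (hd : Distinct3 x y z) :
    nextMean (fun p q r => ENNReal.ofReal (spread x y z / spread p q r)) x y z = 2 := by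
  obtain ⟨l, m, h, hlm, hmh, hs, hb, -, hn⟩ := hd.exists_sorted
  have hF : IsSymm3 (fun p q r => ENNReal.ofReal (spread x y z / spread p q r)) :=
    isSymm3_of_spread_balance fun _ s _ => ENNReal.ofReal (spread x y z / s)
  have hm : Measurable fun p : ℝ × ℝ × ℝ =>
      ENNReal.ofReal (spread x y z / spread p.1 p.2.1 p.2.2) :=
    (measurable_const.div measurable_spread).ennreal_ofReal
  have h1 : 0 < m - l := sub_pos.2 hlm
  have h2 : 0 < h - m := sub_pos.2 hmh
  have h3 : 0 < h - l := sub_pos.2 (hlm.trans hmh)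
  rw [hn _ hF hm, nextMean_eq_of_pow hF hm hlm hmh h3.le 0]
  · rw [show (2 : ℝ≥0∞) = ENNReal.ofReal 2 by simp]
    congr 1
    push_cast
    field_simp
    ring
  · intro a b hab
    refine setLIntegral_Ioo_congr_of (c := (h - l) / (b - a))
      (fun e h1 h2 => by rw [spread_of_lt h1 h2, hs]) ?_ ?_
    · exact div_nonneg h3.le (sub_pos.2 hab).le
    · have := sub_pos.2 hab
      field_simp

lemma Distinct3.nextMean_ratio_pow (hd : Distinct3 x y z) (k : ℕ) {v : ℝ}
    (hv : ∀ l m h, l < m → m < h → balance x y z = (m - l) * (h - m) / (h - l) ^ 2 →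
      v = 2 / ((m - l) * (h - m) * (h - l)) * ((1 / (h - l) ^ k) * (((h - l) ^ (k + 3) -
        (m - l) ^ (k + 3) - (h - m) ^ (k + 3)) / ((k + 2) * (k + 3))))) :
    nextMean (fun p q r => ENNReal.ofReal ((spread p q r / spread x y z) ^ k)) x y z =
      ENNReal.ofReal v := by
  obtain ⟨l, m, h, hlm, hmh, hs, hb, -, hn⟩ := hd.exists_sorted
  have hF : IsSymm3 (fun p q r => ENNReal.ofReal ((spread p q r / spread x y z) ^ k)) :=
    isSymm3_of_spread_balance fun _ s _ => ENNReal.ofReal ((s / spread x y z) ^ k)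
  have hm : Measurable fun p : ℝ × ℝ × ℝ =>
      ENNReal.ofReal ((spread p.1 p.2.1 p.2.2 / spread x y z) ^ k) :=
    ((measurable_spread.div_const _).pow_const _).ennreal_ofReal
  have h3 : 0 < h - l := sub_pos.2 (hlm.trans hmh)
  rw [hn _ hF hm, nextMean_eq_of_pow hF hm hlm hmh (C := 1 / (h - l) ^ k) (by positivity) (k + 1)]
  · rw [hv l m h hlm hmh hb]
    congr 1
    push_cast
    ring
  · intro a b hab
    have := sub_pos.2 hab
    refine setLIntegral_Ioo_congr_of (c := ((b - a) / (h - l)) ^ k)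
      (fun e h1 h2 => by rw [spread_of_lt h1 h2, hs]) (by positivity) ?_
    rw [div_pow]
    ring

lemma Distinct3.nextMean_ratio (hd : Distinct3 x y z) :
    nextMean (fun p q r => ENNReal.ofReal (spread p q r / spread x y z)) x y z =
      ENNReal.ofReal (2 / 3 - balance x y z / 3) := by
  have := hd.nextMean_ratio_pow 1 (v := 2 / 3 - balance x y z / 3) ?_
  · simpa using this
  · intro l m h hlm hmh hb
    have h1 : 0 < m - l := sub_pos.2 hlm
    have h2 : 0 < h - m := sub_pos.2 hmh
    have h3 : 0 < h - l := sub_pos.2 (hlm.trans hmh)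
    rw [hb]
    push_cast
    field_simp
    ring

lemma Distinct3.nextMean_ratio_sq (hd : Distinct3 x y z) :
    nextMean (fun p q r => ENNReal.ofReal ((spread p q r / spread x y z) ^ 2)) x y z =
      ENNReal.ofReal ((1 - balance x y z) / 2) := by
  refine hd.nextMean_ratio_pow 2 fun l m h hlm hmh hb => ?_
  have h1 : 0 < m - l := sub_pos.2 hlm
  have h2 : 0 < h - m := sub_pos.2 hmh
  have h3 : 0 < h - l := sub_pos.2 (hlm.trans hmh)
  rw [hb]
  push_cast
  field_simp
  ring

lemma Distinct3.nextMean_balance (hd : Distinct3 x y z) :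
    nextMean (fun p q r => ENNReal.ofReal (balance p q r)) x y z = ENNReal.ofReal (1 / 6) := by
  obtain ⟨l, m, h, hlm, hmh, hs, hb, -, hn⟩ := hd.exists_sorted
  have hF : IsSymm3 (fun p q r => ENNReal.ofReal (balance p q r)) :=
    isSymm3_of_spread_balance fun _ _ b => ENNReal.ofReal b
  have hm : Measurable fun p : ℝ × ℝ × ℝ => ENNReal.ofReal (balance p.1 p.2.1 p.2.2) :=
    measurable_balance.ennreal_ofReal
  have h1 : 0 < m - l := sub_pos.2 hlm
  have h2 : 0 < h - m := sub_pos.2 hmh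
  have h3 : 0 < h - l := sub_pos.2 (hlm.trans hmh)
  rw [hn _ hF hm, nextMean_eq_of_pow hF hm hlm hmh (C := 1 / 6) (by positivity) 1]
  · congr 1
    push_cast
    field_simp
    ring
  · intro a b hab
    have hab' := sub_pos.2 hab
    rw [setLIntegral_congr_fun (g := fun e => ENNReal.ofReal ((e - a) * (b - e) / (b - a) ^ 2))
      measurableSet_Ioo (fun e he => by rw [balance_of_lt he.1 he.2]),
      setLIntegral_Ioo_ofReal hab.le (by fun_prop)]
    · congr 1
      rw [intervalIntegral.integral_div]
      have : ∀ e, (e - a) * (b - e) = (b - a) * (e - a) - (e - a) ^ 2 := fun e => by ring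
      simp only [this]
      rw [intervalIntegral.integral_comp_sub_right (fun e => (b - a) * e - e ^ 2),
        intervalIntegral.integral_sub (Continuous.intervalIntegrable (by fun_prop) _ _)
        (Continuous.intervalIntegrable (by fun_prop) _ _),
        intervalIntegral.integral_const_mul, integral_id, integral_pow]
      push_cast
      field_simp
      ring
    · intro e he
      have := sub_pos.2 he.1
      have := sub_pos.2 he.2
      positivity

lemma Distinct3.nextMean_not_distinct (hd : Distinct3 x y z) :
    nextMean (fun p q r => {t : ℝ × ℝ × ℝ | ¬ Distinct3 t.1 t.2.1 t.2.2}.indicator 1 (p, q, r))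
      x y z = 0 := by
  obtain ⟨l, m, h, hlm, hmh, hs, hb, -, hn⟩ := hd.exists_sorted
  have hF : IsSymm3 (fun p q r =>
      {t : ℝ × ℝ × ℝ | ¬ Distinct3 t.1 t.2.1 t.2.2}.indicator (1 : ℝ × ℝ × ℝ → ℝ≥0∞) (p, q, r)) :=
    isSymm3_of_spread_balance fun d _ _ => {e : Prop | ¬ e}.indicator 1 d
  have hm : Measurable fun p : ℝ × ℝ × ℝ =>
      {t : ℝ × ℝ × ℝ | ¬ Distinct3 t.1 t.2.1 t.2.2}.indicator (1 : ℝ × ℝ × ℝ → ℝ≥0∞)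
        (p.1, p.2.1, p.2.2) :=
    measurable_one.indicator measurableSet_distinct3.compl
  rw [hn _ hF hm, ← nonpos_iff_eq_zero]
  refine (nextMean_le_of_linear hF hm hlm hmh le_rfl fun a b hab => ?_).trans (by simp)
  rw [setLIntegral_congr_fun (g := fun _ => 0) measurableSet_Ioo]
  · simp
  · intro e he
    have : Distinct3 a e b := ⟨he.1.ne, he.2.ne, (he.1.trans he.2).ne'⟩
    simp [this]

lemma Distinct3.nextMean_balance_le (hd : Distinct3 x y z) {δ : ℝ} (hδ : 0 ≤ δ) :
    nextMean (fun p q r => {t : ℝ × ℝ × ℝ | balance t.1 t.2.1 t.2.2 ≤ δ}.indicator 1 (p, q, r))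
      x y z ≤ ENNReal.ofReal (4 * δ) := by
  obtain ⟨l, m, h, hlm, hmh, hs, hb, -, hn⟩ := hd.exists_sorted
  have hF : IsSymm3 (fun p q r =>
      {t : ℝ × ℝ × ℝ | balance t.1 t.2.1 t.2.2 ≤ δ}.indicator (1 : ℝ × ℝ × ℝ → ℝ≥0∞) (p, q, r)) :=
    isSymm3_of_spread_balance fun _ _ b => {e : ℝ | e ≤ δ}.indicator 1 b
  have hm : Measurable fun p : ℝ × ℝ × ℝ =>
      {t : ℝ × ℝ × ℝ | balance t.1 t.2.1 t.2.2 ≤ δ}.indicator (1 : ℝ × ℝ × ℝ → ℝ≥0∞)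
        (p.1, p.2.1, p.2.2) :=
    measurable_one.indicator (measurableSet_le measurable_balance measurable_const)
  rw [hn _ hF hm]
  refine nextMean_le_of_linear hF hm hlm hmh (by positivity) fun a b hab => ?_
  have hab' := sub_pos.2 hab
  calc _ ≤ ∫⁻ e in Ioo a b, (Icc a (a + 2 * δ * (b - a)) ∪
        Icc (b - 2 * δ * (b - a)) b).indicator 1 e := by
        refine setLIntegral_mono' measurableSet_Ioo fun e he => ?_
        by_cases hbe : balance a e b ≤ δ
        · rw [balance_of_lt he.1 he.2, div_le_iff₀ (by positivity)] at hbe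
          rw [indicator_of_mem (s := Icc _ _ ∪ Icc _ _)]
          · exact indicator_le_self' (by simp) _
          by_contra hcon
          simp only [mem_union, mem_Icc, not_or, not_and, not_le] at hcon
          have h1 := hcon.1 he.1.le
          have h2 : e < b - 2 * δ * (b - a) := by
            by_contra h; exact absurd (hcon.2 (not_lt.1 h)) (not_lt.2 he.2.le)
          rcases le_total (e - a) (b - e) with hh | hh
          · nlinarith [mul_nonneg hδ hab'.le, he.1, he.2]
          · nlinarith [mul_nonneg hδ hab'.le, he.1, he.2]
        · rw [indicator_of_notMem (by simpa using hbe)]; exact zero_le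
    _ ≤ ∫⁻ e, (Icc a (a + 2 * δ * (b - a)) ∪ Icc (b - 2 * δ * (b - a)) b).indicator 1 e :=
        setLIntegral_le_lintegral _ _
    _ = volume (Icc a (a + 2 * δ * (b - a)) ∪ Icc (b - 2 * δ * (b - a)) b) := by
        rw [lintegral_indicator_one (measurableSet_Icc.union measurableSet_Icc)]
    _ ≤ ENNReal.ofReal (2 * δ * (b - a)) + ENNReal.ofReal (2 * δ * (b - a)) := by
        refine (measure_union_le _ _).trans ?_
        rw [Real.volume_Icc, Real.volume_Icc]
        simp
    _ = _ := by
        rw [← ENNReal.ofReal_add (by positivity) (by positivity)]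
        congr 1; ring

end

/-- The uniform distribution on the cube `(0, 1)³`. -/
noncomputable def unitCube : Measure (Fin 3 → ℝ) :=
  Measure.pi fun _ => volume.restrict (Ioo 0 1)

instance isProbabilityMeasure_restrict_Ioo_zero_one :
    IsProbabilityMeasure ((volume : Measure ℝ).restrict (Ioo 0 1)) :=
  ⟨by simp⟩

instance isProbabilityMeasure_unitCube : IsProbabilityMeasure unitCube := by
  unfold unitCube; infer_instance

lemma measurable_vec3 : Measurable fun p : ℝ × ℝ × ℝ => ![p.1, p.2.1, p.2.2] := by
  refine measurable_pi_iff.2 fun i => ?_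
  fin_cases i
  · exact measurable_fst
  · exact measurable_snd.fst
  · exact measurable_snd.snd

lemma unitCube_eq_map : unitCube =
    ((volume.restrict (Ioo (0 : ℝ) 1)).prod ((volume.restrict (Ioo (0 : ℝ) 1)).prod
      (volume.restrict (Ioo (0 : ℝ) 1)))).map fun p => ![p.1, p.2.1, p.2.2] := by
  refine Measure.pi_eq fun s hs => ?_
  rw [Measure.map_apply measurable_vec3 (MeasurableSet.univ_pi hs)]
  have : (fun p : ℝ × ℝ × ℝ => ![p.1, p.2.1, p.2.2]) ⁻¹' univ.pi s = s 0 ×ˢ (s 1 ×ˢ s 2) := by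
    ext p
    simp [Fin.forall_fin_succ]
  rw [this, Measure.prod_prod, Measure.prod_prod, Fin.prod_univ_three]
  ring

lemma lintegral_unitCube {f : (Fin 3 → ℝ) → ℝ≥0∞} (hf : Measurable f) :
    ∫⁻ t, f t ∂unitCube = ∫⁻ a in Ioo (0 : ℝ) 1, ∫⁻ b in Ioo (0 : ℝ) 1,
      ∫⁻ c in Ioo (0 : ℝ) 1, f ![a, b, c] := by
  have hf' : Measurable fun p : ℝ × ℝ × ℝ => f ![p.1, p.2.1, p.2.2] := hf.comp measurable_vec3
  rw [unitCube_eq_map, lintegral_map hf measurable_vec3, lintegral_prod _ hf'.aemeasurable]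
  refine lintegral_congr fun a => ?_
  rw [lintegral_prod]
  exact (hf'.comp (f := fun p : ℝ × ℝ => (a, p.1, p.2)) (by fun_prop)).aemeasurable

/-- The `i`-th point of the triple that follows `x`. -/
def nextPoint (x t : Fin 3 → ℝ) (i : Fin 3) : ℝ := x (i + 1) + t i * (x (i + 2) - x (i + 1))

lemma measurable_nextPoint (x : Fin 3 → ℝ) (i : Fin 3) : Measurable fun t => nextPoint x t i := by
  unfold nextPoint; fun_prop

lemma lintegral_nextPoint {F : ℝ → ℝ → ℝ → ℝ≥0∞}
    (hm : Measurable fun p : ℝ × ℝ × ℝ => F p.1 p.2.1 p.2.2) (x : Fin 3 → ℝ) :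
    ∫⁻ t, F (nextPoint x t 0) (nextPoint x t 1) (nextPoint x t 2) ∂unitCube =
      nextMean F (x 0) (x 1) (x 2) := by
  have h : Measurable fun t => F (nextPoint x t 0) (nextPoint x t 1) (nextPoint x t 2) :=
    hm.comp ((measurable_nextPoint x 0).prodMk
      ((measurable_nextPoint x 1).prodMk (measurable_nextPoint x 2)))
  rw [lintegral_unitCube h]
  rfl

lemma integral_of_lintegral_eq {f : (Fin 3 → ℝ) → ℝ} (hf : Measurable f) (h0 : ∀ t, 0 ≤ f t)
    {v : ℝ} (hv : 0 ≤ v) (h : ∫⁻ t, ENNReal.ofReal (f t) ∂unitCube = ENNReal.ofReal v) :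
    Integrable f unitCube ∧ ∫ t, f t ∂unitCube = v := by
  constructor
  · refine ⟨hf.aestronglyMeasurable, ?_⟩
    rw [hasFiniteIntegral_iff_ofReal (Filter.Eventually.of_forall h0), h]
    exact ENNReal.ofReal_lt_top
  · rw [integral_eq_lintegral_of_nonneg_ae (Filter.Eventually.of_forall h0)
      hf.aestronglyMeasurable, h, ENNReal.toReal_ofReal hv]

/-- The ratio of the areas of consecutive triangles. -/
def areaRatio (t : Fin 3 → ℝ) : ℝ := t 0 * t 1 * t 2 + (1 - t 0) * (1 - t 1) * (1 - t 2)

lemma measurable_areaRatio : Measurable areaRatio := by unfold areaRatio; fun_prop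

lemma integral_pow_mul_one_sub_pow (j l : ℕ) :
    ∫ t in (0 : ℝ)..1, t ^ j * (1 - t) ^ l = 1 / ((j + l + 1) * (j + l).choose j) := by
  induction j generalizing l with
  | zero =>
    simp only [pow_zero, one_mul]
    rw [intervalIntegral.integral_comp_sub_left (fun x => x ^ l), integral_pow]
    simp
  | succ j ih =>
    have hd : ∀ t : ℝ, HasDerivAt (fun t : ℝ => t ^ (j + 1) * (1 - t) ^ (l + 1))
        ((j + 1) * (t ^ j * (1 - t) ^ (l + 1)) - (l + 1) * (t ^ (j + 1) * (1 - t) ^ l)) t := by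
      intro t
      have h := (hasDerivAt_pow (j + 1) t).fun_mul (((hasDerivAt_id t).const_sub 1).fun_pow (l + 1))
      refine h.congr_deriv ?_
      push_cast
      simp only [id]
      ring
    have hi := intervalIntegral.integral_eq_sub_of_hasDerivAt (a := 0) (b := 1) (fun t _ => hd t)
      (Continuous.intervalIntegrable (by fun_prop) _ _)
    rw [intervalIntegral.integral_sub (Continuous.intervalIntegrable (by fun_prop) _ _)
      (Continuous.intervalIntegrable (by fun_prop) _ _), intervalIntegral.integral_const_mul,
      intervalIntegral.integral_const_mul, ih] at hi
    simp only [sub_self, ne_eq, Nat.add_eq_zero_iff, one_ne_zero, and_false, not_false_eq_true,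
      zero_pow, mul_zero, zero_mul] at hi
    have hc : ((j + 1 + l).choose (j + 1) : ℝ) * (j + 1) = (j + (l + 1)).choose j * (l + 1) := by
      have h1 := Nat.choose_succ_right_eq (j + 1 + l) j
      have h2 : j + 1 + l - j = l + 1 := by omega
      rw [h2] at h1
      rw [show j + (l + 1) = j + 1 + l by ring]
      exact_mod_cast h1
    have p1 : (0 : ℝ) < (j + (l + 1)).choose j := by
      exact_mod_cast Nat.choose_pos (by omega)
    have p2 : (0 : ℝ) < (j + 1 + l).choose (j + 1) := by
      exact_mod_cast Nat.choose_pos (by omega)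
    have hl : (0 : ℝ) < l + 1 := by positivity
    push_cast at hi ⊢
    have key : ∫ t in (0 : ℝ)..1, t ^ (j + 1) * (1 - t) ^ l =
        (j + 1) * (1 / ((j + (l + 1) + 1) * ((j + (l + 1)).choose j : ℝ))) / (l + 1) := by
      rw [eq_div_iff hl.ne']
      linarith
    rw [key]
    have q1 : (0 : ℝ) < j + (l + 1) + 1 := by positivity
    have q2 : (0 : ℝ) < j + 1 + l + 1 := by positivity
    rw [div_eq_div_iff hl.ne' (mul_pos q2 p2).ne', mul_one_div,
      div_mul_eq_mul_div, div_eq_iff (mul_pos q1 p1).ne']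
    linear_combination (j + 1 + l + 1 : ℝ) * hc

lemma integral_areaRatio_pow (k : ℕ) : Integrable (fun t => areaRatio t ^ k) unitCube ∧
    ∫ t, areaRatio t ^ k ∂unitCube =
      ∑ j ∈ Finset.range (k + 1), k.choose j * (1 / ((k + 1) * (k.choose j : ℝ))) ^ 3 := by
  have e : ∀ t : Fin 3 → ℝ, areaRatio t ^ k = ∑ j ∈ Finset.range (k + 1),
      (k.choose j : ℝ) * ∏ i, (t i ^ j * (1 - t i) ^ (k - j)) := by
    intro t
    unfold areaRatio
    rw [add_pow]
    refine Finset.sum_congr rfl fun j _ => ?_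
    rw [Fin.prod_univ_three, mul_pow, mul_pow, mul_pow, mul_pow]
    ring
  have hint : ∀ j, Integrable (fun t : Fin 3 → ℝ =>
      (k.choose j : ℝ) * ∏ i, (t i ^ j * (1 - t i) ^ (k - j))) unitCube := by
    intro j
    refine Integrable.const_mul ?_ _
    refine Integrable.fintype_prod (μ := fun _ => volume.restrict (Ioo 0 1))
      (f := fun _ x => x ^ j * (1 - x) ^ (k - j)) fun _ => ?_
    exact ((by fun_prop : Continuous fun x : ℝ => x ^ j * (1 - x) ^ (k - j)).integrableOn_Icc
      (a := 0) (b := 1)).mono_set Ioo_subset_Icc_self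
  simp only [e]
  refine ⟨integrable_finsetSum _ fun j _ => hint j, ?_⟩
  rw [integral_finsetSum _ fun j _ => hint j]
  refine Finset.sum_congr rfl fun j hj => ?_
  have hjk : j ≤ k := Nat.lt_succ_iff.1 (Finset.mem_range.1 hj)
  rw [integral_const_mul, unitCube, integral_fintype_prod_eq_prod (E := fun _ => ℝ)
    (f := fun _ x => x ^ j * (1 - x) ^ (k - j)), Fin.prod_const]
  rw [← integral_Ioc_eq_integral_Ioo, ← intervalIntegral.integral_of_le zero_le_one,
    integral_pow_mul_one_sub_pow, Nat.cast_sub hjk, Nat.add_sub_cancel' hjk]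
  congr 4
  ring

/-- A function on the positive reals whose derivative changes its sign at `m` is minimal there. -/
lemma le_of_deriv_sign_change {f f' : ℝ → ℝ} {m : ℝ} (hm : 0 < m)
    (hd : ∀ x, 0 < x → HasDerivAt f (f' x) x) (hneg : ∀ x, 0 < x → x < m → f' x ≤ 0)
    (hpos : ∀ x, m < x → 0 ≤ f' x) {x : ℝ} (hx : 0 < x) : f m ≤ f x := by
  rcases le_total x m with h | h
  · have : AntitoneOn f (Icc x m) := by
      refine antitoneOn_of_deriv_nonpos (convex_Icc x m)
        (fun y hy => (hd y (hx.trans_le hy.1)).continuousAt.continuousWithinAt)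
        (fun y hy => ?_) fun y hy => ?_
      · rw [interior_Icc] at hy
        exact (hd y (hx.trans hy.1)).differentiableAt.differentiableWithinAt
      · rw [interior_Icc] at hy
        rw [(hd y (hx.trans hy.1)).deriv]
        exact hneg y (hx.trans hy.1) hy.2
    exact this ⟨le_rfl, h⟩ ⟨h, le_rfl⟩ h
  · have : MonotoneOn f (Icc m x) := by
      refine monotoneOn_of_deriv_nonneg (convex_Icc m x)
        (fun y hy => (hd y (hm.trans_le hy.1)).continuousAt.continuousWithinAt)
        (fun y hy => ?_) fun y hy => ?_
      · rw [interior_Icc] at hy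
        exact (hd y (hm.trans hy.1)).differentiableAt.differentiableWithinAt
      · rw [interior_Icc] at hy
        rw [(hd y (hm.trans hy.1)).deriv]
        exact hpos y hy.1
    exact this ⟨le_rfl, h⟩ ⟨h, le_rfl⟩ h

lemma neg_log_le {r : ℝ} (hr : 0 < r) :
    -Real.log r ≤ 1 / 6 * r⁻¹ + Real.log 2 + 1 / 2 - 2 * r + 2 / 3 * r ^ 2 := by
  have h := le_of_deriv_sign_change (m := 1 / 2) (by norm_num)
    (f := fun r => 1 / 6 * r⁻¹ + Real.log 2 + 1 / 2 - 2 * r + 2 / 3 * r ^ 2 + Real.log r)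
    (f' := fun r => (2 * r - 1) ^ 3 / (6 * r ^ 2)) (fun x hx => ?_) (fun x hx hx' => ?_)
    (fun x hx => ?_) hr
  · have : Real.log (1 / 2) = -Real.log 2 := by rw [one_div, Real.log_inv]
    simp only [this] at h
    norm_num at h
    linarith
  · have h := ((((((hasDerivAt_inv hx.ne').const_mul (1 / 6)).add_const (Real.log 2)).add_const
      (1 / 2)).fun_sub ((hasDerivAt_id x).const_mul 2)).fun_add
      ((hasDerivAt_pow 2 x).const_mul (2 / 3))).fun_add (Real.hasDerivAt_log hx.ne')
    refine h.congr_deriv ?_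
    push_cast
    field_simp
    ring
  · refine div_nonpos_of_nonpos_of_nonneg ?_ (by positivity)
    exact Odd.pow_nonpos (by decide) (by linarith)
  · have : 0 ≤ 2 * x - 1 := by linarith
    positivity

/-- The Taylor polynomial of degree seven of the logarithm at `1 / 3`. -/
noncomputable def logBound (q : ℝ) : ℝ :=
  -Real.log 3 - ((1 - 3 * q) + (1 - 3 * q) ^ 2 / 2 + (1 - 3 * q) ^ 3 / 3 + (1 - 3 * q) ^ 4 / 4 +
    (1 - 3 * q) ^ 5 / 5 + (1 - 3 * q) ^ 6 / 6 + (1 - 3 * q) ^ 7 / 7)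

lemma log_le_logBound {q : ℝ} (hq : 0 < q) : Real.log q ≤ logBound q := by
  have h := le_of_deriv_sign_change (m := 1 / 3) (by norm_num)
    (f := fun q => logBound q - Real.log q)
    (f' := fun q => -(1 - 3 * q) ^ 7 / q) (fun x hx => ?_) (fun x hx hx' => ?_)
    (fun x hx => ?_) hq
  · have : Real.log (1 / 3) = -Real.log 3 := by rw [one_div, Real.log_inv]
    simp only [this, logBound] at h
    norm_num at h
    unfold logBound
    linarith
  · unfold logBound
    have l : HasDerivAt (fun q : ℝ => 1 - 3 * q) (-3) x := by
      simpa using ((hasDerivAt_id x).const_mul 3).const_sub 1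
    have h := (((((((l.fun_add ((l.fun_pow 2).div_const 2)).fun_add
      ((l.fun_pow 3).div_const 3)).fun_add ((l.fun_pow 4).div_const 4)).fun_add
      ((l.fun_pow 5).div_const 5)).fun_add ((l.fun_pow 6).div_const 6)).fun_add
      ((l.fun_pow 7).div_const 7)).const_sub (-Real.log 3)).fun_sub (Real.hasDerivAt_log hx.ne')
    refine h.congr_deriv ?_
    push_cast
    field_simp
    ring
  · refine div_nonpos_of_nonpos_of_nonneg ?_ hx.le
    have : 0 ≤ 1 - 3 * x := by linarith
    have := pow_nonneg this 7
    linarith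
  · have : 1 - 3 * x ≤ 0 := by linarith
    have := Odd.pow_nonpos (n := 7) (by decide) this
    exact div_nonneg (by linarith) (by linarith)

lemma abs_logBound_le {q : ℝ} (h0 : 0 ≤ q) (h1 : q ≤ 1) : |logBound q| ≤ 50 := by
  have h3 : Real.log 3 < 2 := by linarith [Real.log_three_lt_d9]
  have h3' : 0 < Real.log 3 := by linarith [Real.log_three_gt_d9]
  have hy : |1 - 3 * q| ≤ 2 := abs_le.2 ⟨by linarith, by linarith⟩
  have hp : ∀ k : ℕ, |(1 - 3 * q) ^ k| ≤ 2 ^ k := fun k => by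
    rw [abs_pow]; gcongr
  have e1 := abs_le.1 hy
  have e2 := abs_le.1 (hp 2)
  have e3 := abs_le.1 (hp 3)
  have e4 := abs_le.1 (hp 4)
  have e5 := abs_le.1 (hp 5)
  have e6 := abs_le.1 (hp 6)
  have e7 := abs_le.1 (hp 7)
  norm_num at e2 e3 e4 e5 e6 e7
  unfold logBound
  exact abs_le.2 ⟨by linarith, by linarith⟩

lemma integral_logBound : Integrable (fun t => logBound (areaRatio t)) unitCube ∧
    ∫ t, logBound (areaRatio t) ∂unitCube = -Real.log 3 - 34511 / 78400 := by
  let b : ℕ → ℝ := fun k => ![-Real.log 3 - 363 / 140, 21, -189 / 2, 315, -2835 / 4, 5103 / 5,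
    -1701 / 2, 2187 / 7] (Fin.ofNat 8 k)
  have e : ∀ q, logBound q = ∑ k ∈ Finset.range 8, b k * q ^ k := by
    intro q
    simp [Finset.sum_range_succ, b, logBound, Fin.ofNat]
    ring
  simp only [e]
  have hi : ∀ k ∈ Finset.range 8, Integrable (fun t => b k * areaRatio t ^ k) unitCube :=
    fun k _ => (integral_areaRatio_pow k).1.const_mul _
  refine ⟨integrable_finsetSum _ hi, ?_⟩
  rw [integral_finsetSum _ hi]
  simp only [integral_const_mul, (integral_areaRatio_pow _).2]
  norm_num [Finset.sum_range_succ, b, Nat.choose, Fin.ofNat]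
  ring

lemma exp_le_one_add_add_sq (z : ℝ) : Real.exp z ≤ 1 + z + z ^ 2 * Real.exp |z| := by
  have h := Complex.norm_exp_sub_sum_le_norm_mul_exp (z : ℂ) 2
  simp only [Finset.sum_range_succ, Finset.range_zero, Finset.sum_empty, pow_zero, Nat.factorial,
    Nat.cast_one, div_one, zero_add, pow_one] at h
  have e : Complex.exp z - (1 + (z : ℂ) / ((1 * 1 : ℕ) : ℂ)) = ((Real.exp z - (1 + z) : ℝ) : ℂ) := by
    push_cast; simp
  simp only [Nat.succ_eq_add_one, zero_add] at h
  rw [e, Complex.norm_real, Complex.norm_real, Real.norm_eq_abs, Real.norm_eq_abs, sq_abs] at h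
  linarith [le_abs_self (Real.exp z - (1 + z))]

/-- The spread of the triple that follows `x`. -/
noncomputable def nextSpread (x t : Fin 3 → ℝ) : ℝ :=
  spread (nextPoint x t 0) (nextPoint x t 1) (nextPoint x t 2)

/-- The balance of the triple that follows `x`. -/
noncomputable def nextBalance (x t : Fin 3 → ℝ) : ℝ :=
  balance (nextPoint x t 0) (nextPoint x t 1) (nextPoint x t 2)

lemma measurable_nextTriple (x : Fin 3 → ℝ) :
    Measurable fun t => (nextPoint x t 0, nextPoint x t 1, nextPoint x t 2) :=
  (measurable_nextPoint x 0).prodMk ((measurable_nextPoint x 1).prodMk (measurable_nextPoint x 2))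

lemma measurable_nextSpread (x : Fin 3 → ℝ) : Measurable (nextSpread x) :=
  measurable_spread.comp (measurable_nextTriple x)

lemma measurable_nextBalance (x : Fin 3 → ℝ) : Measurable (nextBalance x) :=
  measurable_balance.comp (measurable_nextTriple x)

lemma ae_unitCube_mem : ∀ᵐ t ∂unitCube, ∀ i, t i ∈ Ioo (0 : ℝ) 1 := by
  refine ae_all_iff.2 fun i => ?_
  exact (Measure.tendsto_eval_ae_ae (μ := fun _ : Fin 3 => volume.restrict (Ioo (0 : ℝ) 1))
    (i := i)).eventually (ae_restrict_mem measurableSet_Ioo)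

lemma nextPoint_mem_Icc {x t : Fin 3 → ℝ} {l h : ℝ} (hx : ∀ i, x i ∈ Icc l h)
    (ht : ∀ i, t i ∈ Ioo (0 : ℝ) 1) (i : Fin 3) : nextPoint x t i ∈ Icc l h := by
  obtain ⟨a1, a2⟩ := hx (i + 1)
  obtain ⟨b1, b2⟩ := hx (i + 2)
  obtain ⟨c1, c2⟩ := ht i
  unfold nextPoint
  constructor <;> nlinarith

lemma areaRatio_mem {t : Fin 3 → ℝ} (ht : ∀ i, t i ∈ Ioo (0 : ℝ) 1) :
    0 < areaRatio t ∧ areaRatio t ≤ 1 := by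
  obtain ⟨a1, a2⟩ := ht 0
  obtain ⟨b1, b2⟩ := ht 1
  obtain ⟨c1, c2⟩ := ht 2
  have h1 := sub_pos.2 a2
  have h2 := sub_pos.2 b2
  have h3 := sub_pos.2 c2
  unfold areaRatio
  refine ⟨by positivity, ?_⟩
  have e1 : t 0 * t 1 * t 2 ≤ t 0 * 1 * 1 := by gcongr
  have e2 : (1 - t 0) * (1 - t 1) * (1 - t 2) ≤ (1 - t 0) * 1 * 1 := by gcongr <;> linarith
  linarith

section

variable {x : Fin 3 → ℝ}

lemma ae_nextPoint_distinct (hd : Distinct3 (x 0) (x 1) (x 2)) :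
    ∀ᵐ t ∂unitCube, Distinct3 (nextPoint x t 0) (nextPoint x t 1) (nextPoint x t 2) := by
  have h := hd.nextMean_not_distinct
  have hm := measurableSet_distinct3.compl
  rw [← lintegral_nextPoint (F := fun p q r =>
    {t : ℝ × ℝ × ℝ | ¬ Distinct3 t.1 t.2.1 t.2.2}.indicator 1 (p, q, r))
    (measurable_one.indicator hm)] at h
  have hm' : Measurable fun t => {t : ℝ × ℝ × ℝ | ¬ Distinct3 t.1 t.2.1 t.2.2}.indicator
      (1 : ℝ × ℝ × ℝ → ℝ≥0∞) (nextPoint x t 0, nextPoint x t 1, nextPoint x t 2) :=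
    (measurable_one.indicator hm).comp (measurable_nextTriple x)
  rw [lintegral_eq_zero_iff hm'] at h
  filter_upwards [h] with t ht
  by_contra hcon
  simp [hcon] at ht

lemma nextBalance_le_measure (hd : Distinct3 (x 0) (x 1) (x 2)) {δ : ℝ} (hδ : 0 ≤ δ) :
    ∫⁻ t, {t | nextBalance x t ≤ δ}.indicator 1 t ∂unitCube ≤ ENNReal.ofReal (4 * δ) := by
  refine le_trans (le_of_eq ?_) (hd.nextMean_balance_le hδ)
  exact lintegral_nextPoint (F := fun p q r =>
    {t : ℝ × ℝ × ℝ | balance t.1 t.2.1 t.2.2 ≤ δ}.indicator 1 (p, q, r))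
    (measurable_one.indicator (measurableSet_le measurable_balance measurable_const)) x

lemma integral_inv_spreadRatio (hd : Distinct3 (x 0) (x 1) (x 2)) :
    Integrable (fun t => spread (x 0) (x 1) (x 2) / nextSpread x t) unitCube ∧
    ∫ t, spread (x 0) (x 1) (x 2) / nextSpread x t ∂unitCube = 2 := by
  refine integral_of_lintegral_eq (measurable_const.div (measurable_nextSpread x))
    (fun t => div_nonneg (spread_nonneg _ _ _) (spread_nonneg _ _ _)) zero_le_two ?_
  rw [show ENNReal.ofReal 2 = 2 by simp, ← hd.nextMean_inv]
  exact lintegral_nextPoint (F := fun p q r =>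
    ENNReal.ofReal (spread (x 0) (x 1) (x 2) / spread p q r))
    (measurable_const.div measurable_spread).ennreal_ofReal x

lemma integral_spreadRatio (hd : Distinct3 (x 0) (x 1) (x 2)) :
    Integrable (fun t => nextSpread x t / spread (x 0) (x 1) (x 2)) unitCube ∧
    ∫ t, nextSpread x t / spread (x 0) (x 1) (x 2) ∂unitCube =
      2 / 3 - balance (x 0) (x 1) (x 2) / 3 := by
  refine integral_of_lintegral_eq ((measurable_nextSpread x).div_const _)
    (fun t => div_nonneg (spread_nonneg _ _ _) (spread_nonneg _ _ _))
    (by linarith [hd.balance_le]) ?_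
  rw [← hd.nextMean_ratio]
  exact lintegral_nextPoint (F := fun p q r =>
    ENNReal.ofReal (spread p q r / spread (x 0) (x 1) (x 2)))
    (measurable_spread.div_const _).ennreal_ofReal x

lemma integral_spreadRatio_sq (hd : Distinct3 (x 0) (x 1) (x 2)) :
    Integrable (fun t => (nextSpread x t / spread (x 0) (x 1) (x 2)) ^ 2) unitCube ∧
    ∫ t, (nextSpread x t / spread (x 0) (x 1) (x 2)) ^ 2 ∂unitCube =
      (1 - balance (x 0) (x 1) (x 2)) / 2 := by
  refine integral_of_lintegral_eq (((measurable_nextSpread x).div_const _).pow_const 2)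
    (fun t => sq_nonneg _) (by linarith [hd.balance_le]) ?_
  rw [← hd.nextMean_ratio_sq]
  exact lintegral_nextPoint (F := fun p q r =>
    ENNReal.ofReal ((spread p q r / spread (x 0) (x 1) (x 2)) ^ 2))
    ((measurable_spread.div_const _).pow_const 2).ennreal_ofReal x

lemma integral_nextBalance (hd : Distinct3 (x 0) (x 1) (x 2)) :
    Integrable (nextBalance x) unitCube ∧ ∫ t, nextBalance x t ∂unitCube = 1 / 6 := by
  refine integral_of_lintegral_eq (measurable_nextBalance x)
    (fun t => balance_nonneg _ _ _) (by norm_num) ?_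
  rw [← hd.nextMean_balance]
  exact lintegral_nextPoint (F := fun p q r => ENNReal.ofReal (balance p q r))
    measurable_balance.ennreal_ofReal x

/-- An upper bound for the mean of the logarithmic growth rate of the Lyapunov function. -/
noncomputable def driftBound (x t : Fin 3 → ℝ) : ℝ :=
  logBound (areaRatio t) + 2 * (1 / 6 * (spread (x 0) (x 1) (x 2) / nextSpread x t) + Real.log 2 +
    1 / 2 - 2 * (nextSpread x t / spread (x 0) (x 1) (x 2)) +
    2 / 3 * (nextSpread x t / spread (x 0) (x 1) (x 2)) ^ 2) +
  2 / 3 * (nextBalance x t - balance (x 0) (x 1) (x 2))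

lemma integral_driftBound (hd : Distinct3 (x 0) (x 1) (x 2)) :
    Integrable (driftBound x) unitCube ∧
    ∫ t, driftBound x t ∂unitCube = 2 * Real.log 2 - Real.log 3 - 34511 / 78400 - 2 / 9 := by
  obtain ⟨i1, e1⟩ := integral_logBound
  obtain ⟨i2, e2⟩ := integral_inv_spreadRatio hd
  obtain ⟨i3, e3⟩ := integral_spreadRatio hd
  obtain ⟨i4, e4⟩ := integral_spreadRatio_sq hd
  obtain ⟨i5, e5⟩ := integral_nextBalance hd
  have e : driftBound x = fun t => logBound (areaRatio t) +
      (1 / 3 * (spread (x 0) (x 1) (x 2) / nextSpread x t) +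
      (-4 * (nextSpread x t / spread (x 0) (x 1) (x 2)) +
      (4 / 3 * (nextSpread x t / spread (x 0) (x 1) (x 2)) ^ 2 +
      (2 / 3 * nextBalance x t + (2 * Real.log 2 + 1 - 2 / 3 * balance (x 0) (x 1) (x 2)))))) := by
    ext t
    unfold driftBound
    ring
  have j5 := (i5.const_mul (2 / 3)).fun_add
    (integrable_const (2 * Real.log 2 + 1 - 2 / 3 * balance (x 0) (x 1) (x 2)))
  have j4 := (i4.const_mul (4 / 3)).fun_add j5
  have j3 := (i3.const_mul (-4)).fun_add j4
  have j2 := (i2.const_mul (1 / 3)).fun_add j3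
  rw [e]
  refine ⟨i1.fun_add j2, ?_⟩
  dsimp only
  rw [integral_add i1 j2, integral_add (i2.const_mul _) j3, integral_add (i3.const_mul _) j4,
    integral_add (i4.const_mul _) j5, integral_add (i5.const_mul _) (integrable_const _)]
  simp only [integral_const_mul, e1, e2, e3, e4, e5, integral_const, probReal_univ, smul_eq_mul]
  ring

/-- The growth factor of the Lyapunov function, before it is raised to a power. -/
noncomputable def growth (x t : Fin 3 → ℝ) : ℝ :=
  areaRatio t * (spread (x 0) (x 1) (x 2) / nextSpread x t) ^ 2 *
    Real.exp (2 / 3 * (nextBalance x t - balance (x 0) (x 1) (x 2)))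

lemma measurable_growth (x : Fin 3 → ℝ) : Measurable (growth x) := by
  unfold growth
  have h1 := measurable_nextSpread x
  have h2 := measurable_nextBalance x
  have h3 := measurable_areaRatio
  fun_prop

lemma growth_rpow_le (hd : Distinct3 (x 0) (x 1) (x 2)) {t : Fin 3 → ℝ}
    (ht : ∀ i, t i ∈ Ioo (0 : ℝ) 1)
    (hd' : Distinct3 (nextPoint x t 0) (nextPoint x t 1) (nextPoint x t 2)) {s : ℝ} (hs : 0 < s)
    (hs' : s ≤ 1 / 4) :
    growth x t ^ s ≤ 1 + s * driftBound x t +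
      s ^ 2 * (32 * Real.exp 30 * (spread (x 0) (x 1) (x 2) / nextSpread x t)) := by
  have hR : 0 < spread (x 0) (x 1) (x 2) := hd.spread_pos
  have hR' : 0 < nextSpread x t := hd'.spread_pos
  obtain ⟨q0, q1⟩ := areaRatio_mem ht
  have hle : nextSpread x t ≤ spread (x 0) (x 1) (x 2) := by
    obtain ⟨l, m, h, -, -, hs, -, ⟨h0, h1, h2⟩, -⟩ := hd.exists_sorted
    have hx : ∀ i, x i ∈ Icc l h := by
      intro i; fin_cases i <;> assumption
    rw [hs]
    exact spread_le (nextPoint_mem_Icc hx ht 0) (nextPoint_mem_Icc hx ht 1)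
      (nextPoint_mem_Icc hx ht 2)
  set R := spread (x 0) (x 1) (x 2)
  set R' := nextSpread x t
  set b := balance (x 0) (x 1) (x 2) with hb
  set b' := nextBalance x t with hb'
  have hb0 : 0 ≤ b := balance_nonneg _ _ _
  have hb1 : b ≤ 1 / 4 := hd.balance_le
  have hb'0 : 0 ≤ b' := balance_nonneg _ _ _
  have hb'1 : b' ≤ 1 / 4 := hd'.balance_le
  set X := Real.log (R / R') with hX
  have hX0 : 0 ≤ X := Real.log_nonneg ((one_le_div hR').2 hle)
  have hXexp : Real.exp X = R / R' := Real.exp_log (by positivity)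
  have hXle : X ≤ 1 / 6 * (R / R') + Real.log 2 + 1 / 2 - 2 * (R' / R) + 2 / 3 * (R' / R) ^ 2 := by
    have h := neg_log_le (r := R' / R) (by positivity)
    rwa [← Real.log_inv, inv_div] at h
  set Z := logBound (areaRatio t) + 2 * X + 2 / 3 * (b' - b) with hZ
  have hgrowth : growth x t ≤ Real.exp Z := by
    have h1 : areaRatio t ≤ Real.exp (logBound (areaRatio t)) := by
      rw [← Real.log_le_iff_le_exp q0]; exact log_le_logBound q0
    rw [hZ, Real.exp_add, Real.exp_add, two_mul X, Real.exp_add, hXexp]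
    unfold growth
    rw [sq]
    gcongr
  have hg0 : 0 ≤ growth x t := by unfold growth; positivity
  have hZabs : |Z| ≤ 60 + 2 * X := by
    have := abs_le.1 (abs_logBound_le q0.le q1)
    rw [hZ, abs_le]
    constructor <;> linarith
  have hZle : Z ≤ driftBound x t := by
    unfold driftBound
    rw [hZ]
    linarith
  have hw : (60 + 2 * X) ^ 2 ≤ 32 * Real.exp (15 + X / 2) := by
    have := Real.quadratic_le_exp_of_nonneg (x := 15 + X / 2) (by positivity)
    nlinarith
  have hsZ : |s * Z| ≤ 15 + X / 2 := by
    rw [abs_mul, abs_of_pos hs]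
    nlinarith [abs_nonneg Z]
  calc growth x t ^ s ≤ Real.exp Z ^ s := Real.rpow_le_rpow hg0 hgrowth hs.le
    _ = Real.exp (s * Z) := by rw [← Real.exp_mul, mul_comm]
    _ ≤ 1 + s * Z + (s * Z) ^ 2 * Real.exp |s * Z| := exp_le_one_add_add_sq _
    _ ≤ 1 + s * driftBound x t + s ^ 2 * (32 * Real.exp 30 * (R / R')) := by
        have h1 : (s * Z) ^ 2 * Real.exp |s * Z| ≤
            s ^ 2 * ((32 * Real.exp (15 + X / 2)) * Real.exp (15 + X / 2)) := by
          rw [mul_pow, mul_assoc]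
          have : Z ^ 2 ≤ (60 + 2 * X) ^ 2 := by
            rw [← sq_abs Z]; gcongr
          gcongr
          exact this.trans hw
        rw [mul_assoc 32, ← Real.exp_add, show 15 + X / 2 + (15 + X / 2) = 30 + X by ring,
          Real.exp_add, hXexp, ← mul_assoc 32] at h1
        have := mul_le_mul_of_nonneg_left hZle hs.le
        linarith

end

/-- The one-step contraction: a small power of the Lyapunov function decreases on average at
rate `0.37`. -/
lemma exists_lintegral_growth_rpow_le : ∃ s : ℝ, 0 < s ∧
    ∀ x : Fin 3 → ℝ, Distinct3 (x 0) (x 1) (x 2) →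
      ∫⁻ t, ENNReal.ofReal (growth x t ^ s) ∂unitCube ≤
        ENNReal.ofReal (Real.exp (-0.37 * s)) := by
  have hC : 1 ≤ Real.exp 30 := Real.one_le_exp (by norm_num)
  refine ⟨1 / (64 * 250 * Real.exp 30), by positivity, fun x hd => ?_⟩
  set s := 1 / (64 * 250 * Real.exp 30) with hs
  have hs0 : 0 < s := by positivity
  have hs1 : s ≤ 1 / 4 := by
    rw [hs]
    gcongr
    linarith
  have hsC : s * (64 * Real.exp 30) = 1 / 250 := by
    rw [hs]; field_simp
  obtain ⟨i1, e1⟩ := integral_driftBound hd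
  obtain ⟨i2, e2⟩ := integral_inv_spreadRatio hd
  have hint : Integrable (fun t => 1 + s * driftBound x t + s ^ 2 * (32 * Real.exp 30 *
      (spread (x 0) (x 1) (x 2) / nextSpread x t))) unitCube :=
    ((integrable_const 1).fun_add (i1.const_mul s)).fun_add ((i2.const_mul _).const_mul _)
  have hae : ∀ᵐ t ∂unitCube, growth x t ^ s ≤ 1 + s * driftBound x t + s ^ 2 *
      (32 * Real.exp 30 * (spread (x 0) (x 1) (x 2) / nextSpread x t)) := by
    filter_upwards [ae_unitCube_mem, ae_nextPoint_distinct hd] with t ht hd'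
    exact growth_rpow_le hd ht hd' hs0 hs1
  have hpos : ∀ᵐ t ∂unitCube, 0 ≤ 1 + s * driftBound x t + s ^ 2 *
      (32 * Real.exp 30 * (spread (x 0) (x 1) (x 2) / nextSpread x t)) := by
    filter_upwards [hae, ae_unitCube_mem] with t h ht
    refine le_trans (Real.rpow_nonneg ?_ _) h
    have := (areaRatio_mem ht).1
    unfold growth
    positivity
  refine (lintegral_mono_ae (hae.mono fun t ht => ENNReal.ofReal_le_ofReal ht)).trans ?_
  rw [← ofReal_integral_eq_lintegral_ofReal hint hpos]
  refine ENNReal.ofReal_le_ofReal ?_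
  rw [integral_add ((integrable_const 1).fun_add (i1.const_mul s)) ((i2.const_mul _).const_mul _),
    integral_add (integrable_const 1) (i1.const_mul s)]
  simp only [integral_const_mul, e1, e2, integral_const, probReal_univ, smul_eq_mul]
  have h1 := Real.add_one_le_exp (-0.37 * s)
  have h2 : s ^ 2 * (32 * Real.exp 30 * 2) = s * (1 / 250) := by rw [← hsC]; ring
  rw [h2]
  have h3 := Real.log_two_lt_d9
  have h4 := Real.log_three_gt_d9
  nlinarith

/-- Twice the signed area of the triangle `p q r`. -/
def signedArea (p q r : Plane) : ℝ :=
  (q 0 - p 0) * (r 1 - p 1) - (q 1 - p 1) * (r 0 - p 0)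

/-- Twice the signed area of a triangle. -/
def cross (T : Tri) : ℝ := signedArea (T 0) (T 1) (T 2)

lemma signedArea_eq_cross (T : Tri) (i : Fin 3) :
    signedArea (T i) (T (i + 1)) (T (i + 2)) = cross T := by
  unfold cross signedArea
  fin_cases i
  · rfl
  · change (T 2 0 - T 1 0) * (T 0 1 - T 1 1) - (T 2 1 - T 1 1) * (T 0 0 - T 1 0) = _
    ring
  · change (T 0 0 - T 2 0) * (T 1 1 - T 2 1) - (T 0 1 - T 2 1) * (T 1 0 - T 2 0) = _
    ring

lemma lineMap_apply_coord (p q : Plane) (t : ℝ) (j : Fin 2) :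
    (AffineMap.lineMap p q t : Plane) j = p j + t * (q j - p j) := by
  simp [AffineMap.lineMap_apply, add_comm]

lemma subTriangle_apply (T : Tri) (t : Fin 3 → ℝ) (i : Fin 3) (j : Fin 2) :
    subTriangle T t i j = T (i + 1) j + t i * (T (i + 2) j - T (i + 1) j) :=
  lineMap_apply_coord _ _ _ _

lemma cross_subTriangle (T : Tri) (t : Fin 3 → ℝ) :
    cross (subTriangle T t) = areaRatio t * cross T := by
  unfold cross signedArea areaRatio
  simp only [subTriangle_apply]
  simp only [show (0 + 1 : Fin 3) = 1 from rfl, show (0 + 2 : Fin 3) = 2 from rfl,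
    show (1 + 1 : Fin 3) = 2 from rfl, show (1 + 2 : Fin 3) = 0 from rfl,
    show (2 + 1 : Fin 3) = 0 from rfl, show (2 + 2 : Fin 3) = 1 from rfl]
  ring

lemma affineIndependent_iff_cross_ne_zero (T : Tri) : AffineIndependent ℝ T ↔ cross T ≠ 0 := by
  rw [affineIndependent_iff_linearIndependent_vsub ℝ T 0]
  rw [← linearIndependent_equiv (finSuccAboveEquiv (0 : Fin 3))]
  have hf : (fun i : {x : Fin 3 // x ≠ 0} => (T i -ᵥ T 0 : Plane)) ∘
      finSuccAboveEquiv (0 : Fin 3) = ![T 1 - T 0, T 2 - T 0] := by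
    ext i
    fin_cases i <;> rfl
  rw [hf, LinearIndependent.pair_iff]
  have hc : cross T = (T 1 0 - T 0 0) * (T 2 1 - T 0 1) - (T 1 1 - T 0 1) * (T 2 0 - T 0 0) := rfl
  constructor
  · intro h hz
    rw [hc] at hz
    have h1 := h (T 2 1 - T 0 1) (-(T 1 1 - T 0 1)) (by
      ext j; fin_cases j
      · simp; linarith
      · simp; ring)
    have h2 := h (T 2 0 - T 0 0) (-(T 1 0 - T 0 0)) (by
      ext j; fin_cases j
      · simp; ring
      · simp; linarith)
    have h3 := h 1 0 (by
      ext j; fin_cases j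
      · simp; linarith [h2.2]
      · simp; linarith [h1.2])
    exact one_ne_zero h3.1
  · intro hne s t hst
    have e0 : s * (T 1 0 - T 0 0) + t * (T 2 0 - T 0 0) = 0 := by
      simpa using congrArg (fun p : Plane => p 0) hst
    have e1 : s * (T 1 1 - T 0 1) + t * (T 2 1 - T 0 1) = 0 := by
      simpa using congrArg (fun p : Plane => p 1) hst
    have hs : s * cross T = 0 := by
      rw [hc]
      linear_combination (T 2 1 - T 0 1) * e0 - (T 2 0 - T 0 0) * e1
    have ht : t * cross T = 0 := by
      rw [hc]
      linear_combination (T 1 0 - T 0 0) * e1 - (T 1 1 - T 0 1) * e0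
    exact ⟨(mul_eq_zero.1 hs).resolve_right hne, (mul_eq_zero.1 ht).resolve_right hne⟩

lemma dist_sq_eq (p q : Plane) : dist p q ^ 2 = (p 0 - q 0) ^ 2 + (p 1 - q 1) ^ 2 := by
  rw [EuclideanSpace.dist_eq, Real.sq_sqrt (by positivity), Fin.sum_univ_two, Real.dist_eq,
    Real.dist_eq, sq_abs, sq_abs]

lemma infDist_mul_dist_le (p q r : Plane) :
    Metric.infDist p (affineSpan ℝ {q, r} : Set Plane) * dist q r ≤ |signedArea p q r| := by
  rcases eq_or_ne (dist q r) 0 with h | h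
  · rw [h, mul_zero]; exact abs_nonneg _
  set τ := ((p 0 - q 0) * (r 0 - q 0) + (p 1 - q 1) * (r 1 - q 1)) / dist q r ^ 2 with hτ
  have hle : Metric.infDist p (affineSpan ℝ {q, r} : Set Plane) ≤
      dist p (AffineMap.lineMap q r τ : Plane) :=
    Metric.infDist_le_dist_of_mem (AffineMap.lineMap_mem_affineSpan_pair τ q r)
  refine (mul_le_mul_of_nonneg_right hle dist_nonneg).trans ?_
  refine abs_le_of_sq_le_sq' ?_ (abs_nonneg _) |>.2
  rw [mul_pow, sq_abs, dist_sq_eq p, lineMap_apply_coord, lineMap_apply_coord]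
  have hL : (q 0 - r 0) ^ 2 + (q 1 - r 1) ^ 2 ≠ 0 := by
    rw [← dist_sq_eq]; exact pow_ne_zero 2 h
  rw [hτ, dist_sq_eq q r]
  unfold signedArea
  refine le_of_eq ?_
  field_simp
  ring

/-- The images of the vertices of `T` under the linear functional with coefficients `a`, `b`. -/
def proj (a b : ℝ) (T : Tri) (i : Fin 3) : ℝ := a * T i 0 + b * T i 1

lemma proj_subTriangle (a b : ℝ) (T : Tri) (t : Fin 3 → ℝ) (i : Fin 3) :
    proj a b (subTriangle T t) i = nextPoint (proj a b T) t i := by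
  unfold proj nextPoint
  rw [subTriangle_apply, subTriangle_apply]
  ring

lemma abs_proj_sub_le (a b : ℝ) (T : Tri) (i j : Fin 3) :
    |proj a b T i - proj a b T j| ≤ √(a ^ 2 + b ^ 2) * dist (T i) (T j) := by
  refine abs_le_of_sq_le_sq ?_ (by positivity)
  rw [mul_pow, Real.sq_sqrt (by positivity), dist_sq_eq]
  unfold proj
  nlinarith [sq_nonneg (a * (T i 1 - T j 1) - b * (T i 0 - T j 0))]

/-- A functional that separates the vertices of a non-degenerate triangle. -/
lemma exists_proj_distinct {T : Tri} (hT : cross T ≠ 0) :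
    ∃ a b, Distinct3 (proj a b T 0) (proj a b T 1) (proj a b T 2) := by
  refine ⟨((T 2 1 - T 0 1) - 2 * (T 1 1 - T 0 1)) / cross T,
    (2 * (T 1 0 - T 0 0) - (T 2 0 - T 0 0)) / cross T, ?_⟩
  set a := ((T 2 1 - T 0 1) - 2 * (T 1 1 - T 0 1)) / cross T with ha
  set b := (2 * (T 1 0 - T 0 0) - (T 2 0 - T 0 0)) / cross T with hb
  have h1 : proj a b T 1 - proj a b T 0 = 1 := by
    unfold proj
    rw [ha, hb]
    field_simp
    unfold cross signedArea
    ring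
  have h2 : proj a b T 2 - proj a b T 0 = 2 := by
    unfold proj
    rw [ha, hb]
    field_simp
    unfold cross signedArea
    ring
  refine ⟨fun h => ?_, fun h => ?_, fun h => ?_⟩ <;> linarith

/-- The spread of the projected vertices. -/
noncomputable def projSpread (a b : ℝ) (T : Tri) : ℝ :=
  spread (proj a b T 0) (proj a b T 1) (proj a b T 2)

/-- The balance of the projected vertices. -/
noncomputable def projBalance (a b : ℝ) (T : Tri) : ℝ :=
  balance (proj a b T 0) (proj a b T 1) (proj a b T 2)

/-- The projected vertices are pairwise distinct. -/
def ProjDistinct (a b : ℝ) (T : Tri) : Prop :=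
  Distinct3 (proj a b T 0) (proj a b T 1) (proj a b T 2)

lemma projSpread_le {a b : ℝ} {T : Tri} {i : Fin 3} (hi : IsLargestSide T i) :
    projSpread a b T ≤ 3 / 2 * √(a ^ 2 + b ^ 2) * side T i := by
  have h0 := mul_le_mul_of_nonneg_left (hi 0) (Real.sqrt_nonneg (a ^ 2 + b ^ 2))
  have h1 := mul_le_mul_of_nonneg_left (hi 1) (Real.sqrt_nonneg (a ^ 2 + b ^ 2))
  have h2 := mul_le_mul_of_nonneg_left (hi 2) (Real.sqrt_nonneg (a ^ 2 + b ^ 2))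
  have k0 : |proj a b T 1 - proj a b T 2| ≤ √(a ^ 2 + b ^ 2) * side T 0 :=
    abs_proj_sub_le a b T 1 2
  have k1 : |proj a b T 2 - proj a b T 0| ≤ √(a ^ 2 + b ^ 2) * side T 1 :=
    abs_proj_sub_le a b T 2 0
  have k2 : |proj a b T 0 - proj a b T 1| ≤ √(a ^ 2 + b ^ 2) * side T 2 :=
    abs_proj_sub_le a b T 0 1
  unfold projSpread spread
  linarith

/-- The flatness of a triangle is controlled by its area and the spread of a projection. -/
lemma height_div_side_le {a b : ℝ} {T : Tri} {i : Fin 3} (hd : ProjDistinct a b T)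
    (hi : IsLargestSide T i) :
    height T i / side T i ≤ 9 / 4 * (a ^ 2 + b ^ 2) * (|cross T| / projSpread a b T ^ 2) := by
  have hs : 0 < projSpread a b T := hd.spread_pos
  have hle := projSpread_le (a := a) (b := b) hi
  have hside : 0 < side T i := by
    rcases (show 0 ≤ side T i from dist_nonneg).lt_or_eq with h | h
    · exact h
    · rw [← h, mul_zero] at hle; exact absurd hs (not_lt.2 hle)
  have hA : height T i * side T i ≤ |cross T| := by
    rw [← signedArea_eq_cross T i]; exact infDist_mul_dist_le _ _ _
  have hsq : projSpread a b T ^ 2 ≤ 9 / 4 * (a ^ 2 + b ^ 2) * side T i ^ 2 := by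
    calc projSpread a b T ^ 2 ≤ (3 / 2 * √(a ^ 2 + b ^ 2) * side T i) ^ 2 := by gcongr
      _ = _ := by rw [mul_pow, mul_pow, Real.sq_sqrt (by positivity)]; norm_num
  rw [← mul_div_assoc, div_le_div_iff₀ hside (by positivity)]
  have hh : 0 ≤ height T i := Metric.infDist_nonneg
  calc height T i * projSpread a b T ^ 2
      ≤ height T i * (9 / 4 * (a ^ 2 + b ^ 2) * side T i ^ 2) := by gcongr
    _ = 9 / 4 * (a ^ 2 + b ^ 2) * (height T i * side T i) * side T i := by ring
    _ ≤ 9 / 4 * (a ^ 2 + b ^ 2) * |cross T| * side T i := by gcongr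

lemma exists_middle_vertex (x : Fin 3 → ℝ) (hd : Distinct3 (x 0) (x 1) (x 2)) :
    ∃ i, (x (i + 1) - x i) * (x (i + 2) - x i) =
      -(spread (x 0) (x 1) (x 2) ^ 2 * balance (x 0) (x 1) (x 2)) := by
  have key : ∀ l m h : ℝ, l < m → m < h →
      (l - m) * (h - m) = -(spread l m h ^ 2 * balance l m h) := by
    intro l m h hlm hmh
    have := sub_pos.2 (hlm.trans hmh)
    rw [spread_of_lt hlm hmh, balance_of_lt hlm hmh]
    field_simp
    ring
  obtain ⟨h01, h12, h20⟩ := hd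
  rcases lt_or_gt_of_ne h01 with a | a <;> rcases lt_or_gt_of_ne h12 with b | b <;>
    rcases lt_or_gt_of_ne h20 with c | c
  · linarith
  · refine ⟨1, ?_⟩
    rw [← key _ _ _ a b]
    exact mul_comm _ _
  · refine ⟨0, ?_⟩
    have := key _ _ _ c a
    rw [spread_swap12, spread_swap23, balance_swap12, balance_swap23] at this
    rw [← this]
    exact mul_comm _ _
  · refine ⟨2, ?_⟩
    have := key _ _ _ c b
    rw [spread_swap23, balance_swap23] at this
    rw [← this]
    rfl
  · refine ⟨2, ?_⟩
    have := key _ _ _ b c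
    rw [spread_swap23, spread_swap12, balance_swap23, balance_swap12] at this
    rw [← this]
    exact mul_comm _ _
  · refine ⟨0, ?_⟩
    have := key _ _ _ a c
    rw [spread_swap12, balance_swap12] at this
    rw [← this]
    rfl
  · refine ⟨1, ?_⟩
    have := key _ _ _ b a
    rw [spread_swap23, spread_swap12, spread_swap23, balance_swap23, balance_swap12,
      balance_swap23] at this
    rw [← this]
    rfl
  · linarith

lemma maxAngle_le_pi (T : Tri) : maxAngle T ≤ Real.pi :=
  ciSup_le fun _ => EuclideanGeometry.angle_le_pi _ _ _

lemma angle_le_maxAngle (T : Tri) (i : Fin 3) :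
    EuclideanGeometry.angle (T (i + 1)) (T i) (T (i + 2)) ≤ maxAngle T :=
  le_ciSup (f := fun i : Fin 3 => EuclideanGeometry.angle (T (i + 1)) (T i) (T (i + 2)))
    (finite_range _).bddAbove i

lemma two_mul_mul_sub_sq_le (a b v0 v1 w0 w1 : ℝ) :
    (2 * ((a * v0 + b * v1) * (a * w0 + b * w1)) - (a ^ 2 + b ^ 2) * (v0 * w0 + v1 * w1)) ^ 2 ≤
      (a ^ 2 + b ^ 2) ^ 2 * ((v0 ^ 2 + v1 ^ 2) * (w0 ^ 2 + w1 ^ 2)) := by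
  rw [← sub_nonneg]
  have e : (a ^ 2 + b ^ 2) ^ 2 * ((v0 ^ 2 + v1 ^ 2) * (w0 ^ 2 + w1 ^ 2)) -
      (2 * ((a * v0 + b * v1) * (a * w0 + b * w1)) - (a ^ 2 + b ^ 2) * (v0 * w0 + v1 * w1)) ^ 2 =
      ((a ^ 2 - b ^ 2) * (v0 * w1 + v1 * w0) - 2 * a * b * (v0 * w0 - v1 * w1)) ^ 2 := by
    ring
  rw [e]
  exact sq_nonneg _

/-- If a linear functional takes values of different signs at two vectors and these are large
compared with the area spanned by the vectors, then the angle between the vectors is close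
to `π`. -/
lemma pi_sub_le_angle {a b : ℝ} {p q r : Plane} {m : ℝ} (hm : 0 < m)
    (hpr : (a * (q 0 - p 0) + b * (q 1 - p 1)) * (a * (r 0 - p 0) + b * (r 1 - p 1)) = -m)
    (hlt : (a ^ 2 + b ^ 2) * |signedArea p q r| < m) :
    Real.pi - Real.pi / 2 * ((a ^ 2 + b ^ 2) * |signedArea p q r| / m) ≤
      EuclideanGeometry.angle q p r := by
  set N := a ^ 2 + b ^ 2 with hN
  set D := |signedArea p q r| with hD
  have hN0 : 0 ≤ N := by positivity
  have hD0 : 0 ≤ D := abs_nonneg _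
  set v0 := q 0 - p 0 with hv0
  set v1 := q 1 - p 1 with hv1
  set w0 := r 0 - p 0 with hw0
  set w1 := r 1 - p 1 with hw1
  have hDs : D ^ 2 = (v0 * w1 - v1 * w0) ^ 2 := sq_abs _
  set A := dist q p with hA
  set B := dist r p with hB
  have hAs : A ^ 2 = v0 ^ 2 + v1 ^ 2 := dist_sq_eq _ _
  have hBs : B ^ 2 = w0 ^ 2 + w1 ^ 2 := dist_sq_eq _ _
  have hA0 : 0 ≤ A := dist_nonneg
  have hB0 : 0 ≤ B := dist_nonneg
  set I := v0 * w0 + v1 * w1 with hI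
  have hLag : (A * B) ^ 2 = I ^ 2 + D ^ 2 := by
    rw [mul_pow, hAs, hBs, hDs, hI]; ring
  -- the product of the values is at least `N / 2 * (I - A * B)`
  have hAB : m ≤ N / 2 * (A * B - I) := by
    have h1 : (-2 * m - N * I) ^ 2 ≤ (N * (A * B)) ^ 2 := by
      rw [mul_pow N, mul_pow A, hAs, hBs, show -2 * m = 2 * -m by ring, ← hpr]
      exact two_mul_mul_sub_sq_le a b v0 v1 w0 w1
    have := (abs_le_of_sq_le_sq' h1 (by positivity)).1
    linarith
  have hI0 : I < 0 := by
    by_contra hcon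
    have hI0 := not_lt.1 hcon
    have : A * B ≤ I + D := by
      refine (abs_le_of_sq_le_sq' ?_ (by positivity)).2
      rw [hLag]
      linarith [mul_nonneg hI0 hD0, add_sq I D]
    have h1 : N / 2 * (A * B - I) ≤ N / 2 * D :=
      mul_le_mul_of_nonneg_left (by linarith) (by linarith)
    linarith [mul_nonneg hN0 hD0]
  have hABm : m ≤ N * (A * B) := by
    have : |I| ≤ A * B := abs_le_of_sq_le_sq (by rw [hLag]; linarith [sq_nonneg D]) (by positivity)
    have h1 : N / 2 * (A * B - I) ≤ N / 2 * (2 * (A * B)) :=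
      mul_le_mul_of_nonneg_left (by linarith [(abs_le.1 this).1]) (by linarith)
    linarith
  have hABpos : 0 < A * B := by
    by_contra hcon
    have : A * B = 0 := le_antisymm (not_lt.1 hcon) (by positivity)
    rw [this, mul_zero] at hABm
    linarith
  set θ := EuclideanGeometry.angle q p r with hθ
  have hinner : inner ℝ (q -ᵥ p) (r -ᵥ p) = I := by
    simp [EuclideanSpace.inner_eq_star_dotProduct, dotProduct, Fin.sum_univ_two, hI, hv0, hv1, hw0,
      hw1]
    ring
  have hcos : Real.cos θ * (A * B) = I := by
    have := InnerProductGeometry.cos_angle_mul_norm_mul_norm (q -ᵥ p) (r -ᵥ p)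
    rw [hinner, ← dist_eq_norm_vsub, ← dist_eq_norm_vsub] at this
    exact this
  have hcosneg : Real.cos θ < 0 := by
    by_contra hcon
    have := mul_nonneg (not_lt.1 hcon) hABpos.le
    linarith
  have hθpi : θ ≤ Real.pi := EuclideanGeometry.angle_le_pi _ _ _
  have hθ2 : Real.pi / 2 < θ := by
    by_contra hcon
    exact absurd (Real.cos_nonneg_of_neg_pi_div_two_le_of_le
      (by linarith [Real.pi_pos, EuclideanGeometry.angle_nonneg q p r]) (not_lt.1 hcon))
      (not_le.2 hcosneg)
  have hsin : Real.sin θ * (A * B) = D := by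
    have hs0 : 0 ≤ Real.sin θ :=
      Real.sin_nonneg_of_nonneg_of_le_pi (EuclideanGeometry.angle_nonneg _ _ _) hθpi
    have : (Real.sin θ * (A * B)) ^ 2 = D ^ 2 := by
      rw [mul_pow, Real.sin_sq, sub_mul, ← mul_pow, hcos, hLag]; ring
    exact (pow_left_inj₀ (by positivity) hD0 two_ne_zero).1 this
  have hsin' : Real.sin θ ≤ N * D / m := by
    rw [le_div_iff₀ hm, ← hsin]
    have hs0 : 0 ≤ Real.sin θ :=
      Real.sin_nonneg_of_nonneg_of_le_pi (EuclideanGeometry.angle_nonneg _ _ _) hθpi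
    calc Real.sin θ * m ≤ Real.sin θ * (N * (A * B)) := mul_le_mul_of_nonneg_left hABm hs0
      _ = N * (Real.sin θ * (A * B)) := by ring
  have hjor := Real.mul_le_sin (x := Real.pi - θ) (by linarith) (by linarith)
  rw [Real.sin_pi_sub] at hjor
  have : Real.pi - θ ≤ Real.pi / 2 * Real.sin θ := by
    have h := mul_le_mul_of_nonneg_left hjor (by positivity : (0 : ℝ) ≤ Real.pi / 2)
    have e : Real.pi / 2 * (2 / Real.pi * (Real.pi - θ)) = Real.pi - θ := by
      field_simp
    linarith
  have := mul_le_mul_of_nonneg_left hsin' (by positivity : (0 : ℝ) ≤ Real.pi / 2)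
  linarith

lemma pi_sub_le_maxAngle {a b : ℝ} {T : Tri} (hd : ProjDistinct a b T)
    (hlt : (a ^ 2 + b ^ 2) * (|cross T| / (projSpread a b T ^ 2 * projBalance a b T)) < 1) :
    Real.pi - Real.pi / 2 * ((a ^ 2 + b ^ 2) *
      (|cross T| / (projSpread a b T ^ 2 * projBalance a b T))) ≤ maxAngle T := by
  obtain ⟨i, hi⟩ := exists_middle_vertex (proj a b T) hd
  have hm : 0 < projSpread a b T ^ 2 * projBalance a b T :=
    mul_pos (pow_pos hd.spread_pos 2) hd.balance_pos
  refine le_trans ?_ (angle_le_maxAngle T i)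
  rw [← mul_div_assoc] at hlt ⊢
  rw [div_lt_one hm] at hlt
  rw [← signedArea_eq_cross T i] at hlt ⊢
  refine pi_sub_le_angle hm ?_ hlt
  unfold projSpread projBalance
  rw [← hi]
  unfold proj
  ring

/-- The Lyapunov function. -/
noncomputable def lyapunov (a b s : ℝ) (T : Tri) : ℝ≥0∞ :=
  open Classical in
  if ProjDistinct a b T then
    ENNReal.ofReal ((|cross T| / projSpread a b T ^ 2 *
      Real.exp (2 / 3 * projBalance a b T)) ^ s)
  else ⊤

lemma measurable_vertex_coord (i : Fin 3) (j : Fin 2) : Measurable fun T : Tri => T i j := by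
  fun_prop

lemma measurable_proj3 (a b : ℝ) :
    Measurable fun T : Tri => (proj a b T 0, proj a b T 1, proj a b T 2) := by
  have h : ∀ i, Measurable fun T : Tri => proj a b T i := fun i =>
    ((measurable_vertex_coord i 0).const_mul a).add ((measurable_vertex_coord i 1).const_mul b)
  exact (h 0).prodMk ((h 1).prodMk (h 2))

lemma measurable_projSpread (a b : ℝ) : Measurable (projSpread a b) :=
  measurable_spread.comp (measurable_proj3 a b)

lemma measurable_projBalance (a b : ℝ) : Measurable (projBalance a b) :=
  measurable_balance.comp (measurable_proj3 a b)

lemma measurableSet_projDistinct (a b : ℝ) : MeasurableSet {T | ProjDistinct a b T} :=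
  measurable_proj3 a b measurableSet_distinct3

lemma measurable_cross : Measurable cross := by
  have h := measurable_vertex_coord
  unfold cross signedArea
  fun_prop

lemma measurable_lyapunov (a b s : ℝ) : Measurable (lyapunov a b s) := by
  have h1 := measurable_projSpread a b
  have h2 := measurable_projBalance a b
  have h3 : Measurable fun T => |cross T| := by
    simpa only [Real.norm_eq_abs] using measurable_cross.norm
  refine Measurable.ite (measurableSet_projDistinct a b) ?_ measurable_const
  refine Measurable.ennreal_ofReal ?_
  fun_prop

lemma measurable_subTriangle : Measurable fun p : Tri × (Fin 3 → ℝ) => subTriangle p.1 p.2 := by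
  unfold subTriangle
  simp only [AffineMap.lineMap_apply]
  refine measurable_pi_iff.2 fun i => ?_
  simp only [vsub_eq_sub, vadd_eq_add]
  fun_prop

lemma lintegral_lyapunov_subTriangle_le {a b s : ℝ}
    (hs : ∀ x : Fin 3 → ℝ, Distinct3 (x 0) (x 1) (x 2) →
      ∫⁻ t, ENNReal.ofReal (growth x t ^ s) ∂unitCube ≤ ENNReal.ofReal (Real.exp (-0.37 * s)))
    (T : Tri) : ∫⁻ t, lyapunov a b s (subTriangle T t) ∂unitCube ≤
      ENNReal.ofReal (Real.exp (-0.37 * s)) * lyapunov a b s T := by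
  by_cases hd : ProjDistinct a b T
  swap
  · rw [lyapunov, if_neg hd, ENNReal.mul_top]
    · exact le_top
    · simpa using Real.exp_pos _
  have hsp : 0 < projSpread a b T := hd.spread_pos
  have hstep : ∀ᵐ t ∂unitCube, lyapunov a b s (subTriangle T t) =
      ENNReal.ofReal (growth (proj a b T) t ^ s) * lyapunov a b s T := by
    filter_upwards [ae_unitCube_mem, ae_nextPoint_distinct hd] with t ht hd'
    have hd'' : ProjDistinct a b (subTriangle T t) := by
      unfold ProjDistinct; simpa only [proj_subTriangle] using hd'
    have hq := (areaRatio_mem ht).1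
    have hS : projSpread a b (subTriangle T t) = nextSpread (proj a b T) t := by
      unfold projSpread nextSpread; simp only [proj_subTriangle]
    have hB : projBalance a b (subTriangle T t) = nextBalance (proj a b T) t := by
      unfold projBalance nextBalance; simp only [proj_subTriangle]
    have hsp' : 0 < nextSpread (proj a b T) t := hd'.spread_pos
    rw [lyapunov, if_pos hd'', lyapunov, if_pos hd, hS, hB, cross_subTriangle, abs_mul,
      abs_of_pos hq]
    have hg : 0 ≤ growth (proj a b T) t := by unfold growth; positivity
    rw [← ENNReal.ofReal_mul (Real.rpow_nonneg hg _),
      ← Real.mul_rpow hg (by positivity)]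
    congr 2
    have hee : Real.exp (2 / 3 * nextBalance (proj a b T) t) =
        Real.exp (2 / 3 * (nextBalance (proj a b T) t - projBalance a b T)) *
        Real.exp (2 / 3 * projBalance a b T) := by
      rw [← Real.exp_add]; congr 1; ring
    rw [hee]
    unfold growth
    change _ = areaRatio t * (projSpread a b T / _) ^ 2 * Real.exp (2 / 3 * (_ - projBalance a b T))
      * _
    field_simp
  rw [lintegral_congr_ae hstep, lintegral_mul_const]
  · gcongr
    exact hs _ hd
  · exact ((measurable_growth _).pow_const s).ennreal_ofReal

lemma triangleSeq_congr (T₀ : Tri) {t t' : ℕ → Fin 3 → ℝ} {n : ℕ} (h : ∀ k < n, t k = t' k) :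
    triangleSeq T₀ t n = triangleSeq T₀ t' n := by
  induction n with
  | zero => rfl
  | succ n ih =>
    change subTriangle (triangleSeq T₀ t n) (t n) = subTriangle (triangleSeq T₀ t' n) (t' n)
    rw [ih fun k hk => h k (hk.trans n.lt_succ_self), h n n.lt_succ_self]

lemma measurable_triangleSeq {α : Type*} [MeasurableSpace α] (T₀ : Tri) {g : α → ℕ → Fin 3 → ℝ}
    (hg : ∀ k i, Measurable fun x => g x k i) (n : ℕ) :
    Measurable fun x => triangleSeq T₀ (g x) n := by
  induction n with
  | zero => exact measurable_const
  | succ n ih =>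
    have key : ∀ (u : α → Tri) (v : α → Fin 3 → ℝ), Measurable u → Measurable v →
        Measurable fun x => subTriangle (u x) (v x) := by
      intro u v hu hv
      have h := measurable_subTriangle.comp (hu.prodMk hv)
      exact h
    exact key _ _ ih (measurable_pi_iff.2 (hg n))

section

variable {Ω : Type*} [MeasurableSpace Ω] {μ : Measure Ω} {ξ : ℕ → Fin 3 → Ω → ℝ}

lemma map_eq_restrict_Ioo_of_isUniform {X : Ω → ℝ}
    (h : pdf.IsUniform X (Icc 0 1) μ volume) : μ.map X = volume.restrict (Ioo 0 1) := by
  have h' : μ.map X = ProbabilityTheory.cond volume (Icc 0 1) := h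
  rw [h', ProbabilityTheory.cond, Real.volume_Icc]
  simp [Measure.restrict_congr_set (Ioo_ae_eq_Icc (a := (0 : ℝ)) (b := 1) (μ := volume))]

lemma aemeasurable_of_isUniform {X : Ω → ℝ}
    (h : pdf.IsUniform X (Icc 0 1) μ volume) : AEMeasurable X μ :=
  h.aemeasurable (by simp) (by simp)

lemma ae_mem_Ioo_of_isUniform (hξ_unif : ∀ n i, pdf.IsUniform (ξ n i) (Icc 0 1) μ volume) :
    ∀ᵐ ω ∂μ, ∀ n i, ξ n i ω ∈ Ioo (0 : ℝ) 1 := by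
  refine ae_all_iff.2 fun n => ae_all_iff.2 fun i => ?_
  refine ae_of_ae_map (aemeasurable_of_isUniform (hξ_unif n i)) (p := fun x => x ∈ Ioo (0 : ℝ) 1) ?_
  rw [map_eq_restrict_Ioo_of_isUniform (hξ_unif n i)]
  exact ae_restrict_mem measurableSet_Ioo

lemma map_eq_unitCube (hξ_indep : ProbabilityTheory.iIndepFun (fun p : ℕ × Fin 3 => ξ p.1 p.2) μ)
    (hξ_unif : ∀ n i, pdf.IsUniform (ξ n i) (Icc 0 1) μ volume) (n : ℕ) :
    μ.map (fun ω i => ξ n i ω) = unitCube := by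
  have h : ProbabilityTheory.iIndepFun (fun i : Fin 3 => ξ n i) μ :=
    hξ_indep.precomp (g := fun i : Fin 3 => (n, i)) fun i j hij => by simpa using hij
  rw [h.map_fun_eq_pi_map fun i => aemeasurable_of_isUniform (hξ_unif n i), unitCube]
  congr 1
  ext1 i
  exact map_eq_restrict_Ioo_of_isUniform (hξ_unif n i)

lemma aemeasurable_and_indepFun_triangleSeq
    (hξ_indep : ProbabilityTheory.iIndepFun (fun p : ℕ × Fin 3 => ξ p.1 p.2) μ)
    (hξ_unif : ∀ n i, pdf.IsUniform (ξ n i) (Icc 0 1) μ volume) (T₀ : Tri) (n : ℕ) :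
    AEMeasurable (fun ω => triangleSeq T₀ (fun k i => ξ k i ω) n) μ ∧
    ProbabilityTheory.IndepFun (fun ω => triangleSeq T₀ (fun k i => ξ k i ω) n)
      (fun ω i => ξ n i ω) μ := by
  classical
  set S : Finset (ℕ × Fin 3) := Finset.range n ×ˢ Finset.univ with hS
  set S' : Finset (ℕ × Fin 3) := {n} ×ˢ Finset.univ with hS'
  have hdisj : Disjoint S S' := by
    rw [Finset.disjoint_left]
    rintro ⟨k, i⟩ h1 h2
    simp only [hS, hS', Finset.mem_product, Finset.mem_range, Finset.mem_singleton,
      Finset.mem_univ, and_true] at h1 h2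
    omega
  have ham : ∀ p : ℕ × Fin 3, AEMeasurable (ξ p.1 p.2) μ := fun p =>
    aemeasurable_of_isUniform (hξ_unif p.1 p.2)
  have hind := hξ_indep.indepFun_finset₀ S S' hdisj ham
  set F : (S → ℝ) → Tri := fun v =>
    triangleSeq T₀ (fun k i => if h : (k, i) ∈ S then v ⟨(k, i), h⟩ else 0) n with hF
  have hFm : Measurable F := by
    refine measurable_triangleSeq T₀ (fun k i => ?_) n
    by_cases h : (k, i) ∈ S
    · simp only [h, dite_true]; exact measurable_pi_apply _
    · simp only [h, dite_false]; exact measurable_const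
  have hGm : Measurable fun (w : S' → ℝ) (i : Fin 3) => w ⟨(n, i), by simp [hS']⟩ :=
    measurable_pi_iff.2 fun i => measurable_pi_apply _
  have hT : (fun ω => triangleSeq T₀ (fun k i => ξ k i ω) n) =
      F ∘ fun ω (p : S) => ξ (p : ℕ × Fin 3).1 (p : ℕ × Fin 3).2 ω := by
    ext1 ω
    refine triangleSeq_congr T₀ fun k hk => ?_
    ext i
    simp [hS, hk]
  rw [hT]
  exact ⟨hFm.comp_aemeasurable (aemeasurable_pi_iff.2 fun p => ham p), hind.comp hFm hGm⟩

variable [IsProbabilityMeasure μ]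

/-- The Markov property of the sequence of triangles. -/
lemma lintegral_triangleSeq_succ
    (hξ_indep : ProbabilityTheory.iIndepFun (fun p : ℕ × Fin 3 => ξ p.1 p.2) μ)
    (hξ_unif : ∀ n i, pdf.IsUniform (ξ n i) (Icc 0 1) μ volume) (T₀ : Tri) (n : ℕ)
    {W : Tri → ℝ≥0∞} (hW : Measurable W) :
    ∫⁻ ω, W (triangleSeq T₀ (fun k i => ξ k i ω) (n + 1)) ∂μ =
      ∫⁻ ω, ∫⁻ t, W (subTriangle (triangleSeq T₀ (fun k i => ξ k i ω) n) t) ∂unitCube ∂μ := by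
  obtain ⟨hm, hi⟩ := aemeasurable_and_indepFun_triangleSeq hξ_indep hξ_unif T₀ n
  have hm' : AEMeasurable (fun ω i => ξ n i ω) μ :=
    aemeasurable_pi_iff.2 fun i => aemeasurable_of_isUniform (hξ_unif n i)
  have hmap := hi.map_prod_eq_prod_map_map hm hm'
  rw [map_eq_unitCube hξ_indep hξ_unif] at hmap
  have hWs : Measurable fun p : Tri × (Fin 3 → ℝ) => W (subTriangle p.1 p.2) :=
    hW.comp measurable_subTriangle
  calc _ = ∫⁻ p, W (subTriangle p.1 p.2) ∂(μ.map fun ω =>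
        (triangleSeq T₀ (fun k i => ξ k i ω) n, fun i => ξ n i ω)) := by
        rw [lintegral_map' hWs.aemeasurable (hm.prodMk hm')]
        rfl
    _ = _ := by
        rw [hmap, lintegral_prod _ hWs.aemeasurable,
          lintegral_map' hWs.lintegral_prod_right'.aemeasurable hm]

lemma lintegral_lyapunov_le
    (hξ_indep : ProbabilityTheory.iIndepFun (fun p : ℕ × Fin 3 => ξ p.1 p.2) μ)
    (hξ_unif : ∀ n i, pdf.IsUniform (ξ n i) (Icc 0 1) μ volume) (T₀ : Tri) (a b : ℝ) {s : ℝ}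
    (hs : ∀ x : Fin 3 → ℝ, Distinct3 (x 0) (x 1) (x 2) →
      ∫⁻ t, ENNReal.ofReal (growth x t ^ s) ∂unitCube ≤ ENNReal.ofReal (Real.exp (-0.37 * s)))
    (n : ℕ) : ∫⁻ ω, lyapunov a b s (triangleSeq T₀ (fun k i => ξ k i ω) n) ∂μ ≤
      ENNReal.ofReal (Real.exp (-0.37 * s)) ^ n * lyapunov a b s T₀ := by
  induction n with
  | zero =>
    simp [triangleSeq]
  | succ n ih =>
    rw [lintegral_triangleSeq_succ hξ_indep hξ_unif T₀ n (measurable_lyapunov a b s)]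
    refine (lintegral_mono fun ω => lintegral_lyapunov_subTriangle_le hs _).trans ?_
    rw [lintegral_const_mul' _ _ ENNReal.ofReal_ne_top, pow_succ', mul_assoc]
    gcongr

/-- The area decays faster than the square of the spread of a projection. -/
lemma ae_eventually_area_le
    (hξ_indep : ProbabilityTheory.iIndepFun (fun p : ℕ × Fin 3 => ξ p.1 p.2) μ)
    (hξ_unif : ∀ n i, pdf.IsUniform (ξ n i) (Icc 0 1) μ volume) {T₀ : Tri} {a b : ℝ}
    (hd : ProjDistinct a b T₀) {c : ℝ} (hc : c < 0.37) (K : ℝ) :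
    ∀ᵐ ω ∂μ, ∀ᶠ n : ℕ in atTop,
      ProjDistinct a b (triangleSeq T₀ (fun k i => ξ k i ω) n) ∧
      K * (|cross (triangleSeq T₀ (fun k i => ξ k i ω) n)| /
        projSpread a b (triangleSeq T₀ (fun k i => ξ k i ω) n) ^ 2) ≤ Real.exp (-c * n) := by
  obtain ⟨s, hs0, hs⟩ := exists_lintegral_growth_rpow_le
  have hL0 : lyapunov a b s T₀ ≠ ⊤ := by
    rw [lyapunov, if_pos hd]; exact ENNReal.ofReal_ne_top
  have hmeas : ∀ n : ℕ, AEMeasurable (fun ω => ENNReal.ofReal (Real.exp (s * c)) ^ n *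
      lyapunov a b s (triangleSeq T₀ (fun k i => ξ k i ω) n)) μ := fun n =>
    ((measurable_lyapunov a b s).comp_aemeasurable
      (aemeasurable_and_indepFun_triangleSeq hξ_indep hξ_unif T₀ n).1).const_mul _
  have hsum : ∫⁻ ω, ∑' n : ℕ, ENNReal.ofReal (Real.exp (s * c)) ^ n *
      lyapunov a b s (triangleSeq T₀ (fun k i => ξ k i ω) n) ∂μ ≠ ⊤ := by
    rw [lintegral_tsum hmeas]
    have hle : ∀ n : ℕ, ∫⁻ ω, ENNReal.ofReal (Real.exp (s * c)) ^ n *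
        lyapunov a b s (triangleSeq T₀ (fun k i => ξ k i ω) n) ∂μ ≤
        ENNReal.ofReal (Real.exp (s * (c - 0.37))) ^ n * lyapunov a b s T₀ := by
      intro n
      rw [lintegral_const_mul' _ _ (ENNReal.pow_ne_top ENNReal.ofReal_ne_top)]
      refine (mul_le_mul' le_rfl
        (lintegral_lyapunov_le hξ_indep hξ_unif T₀ a b hs n)).trans (le_of_eq ?_)
      rw [← mul_assoc, ← mul_pow, ← ENNReal.ofReal_mul (Real.exp_pos _).le, ← Real.exp_add]
      congr 4
      ring
    refine ne_top_of_le_ne_top ?_ (ENNReal.tsum_le_tsum hle)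
    rw [ENNReal.tsum_mul_right, ENNReal.tsum_geometric]
    refine ENNReal.mul_ne_top (ENNReal.inv_ne_top.2 (tsub_pos_of_lt ?_).ne') hL0
    rw [← ENNReal.ofReal_one]
    refine (ENNReal.ofReal_lt_ofReal_iff one_pos).2 (Real.exp_lt_one_iff.2 ?_)
    exact mul_neg_of_pos_of_neg hs0 (by linarith)
  filter_upwards [ae_lt_top' (AEMeasurable.tsum hmeas) hsum] with ω hω
  have htend := ENNReal.tendsto_atTop_zero_of_tsum_ne_top hω.ne
  set η : ℝ := (1 / (|K| + 1)) ^ s with hη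
  have hη0 : 0 < η := by positivity
  filter_upwards [htend.eventually (gt_mem_nhds (ENNReal.ofReal_pos.2 hη0))] with n hn
  set T := triangleSeq T₀ (fun k i => ξ k i ω) n
  have hdT : ProjDistinct a b T := by
    by_contra hcon
    rw [lyapunov, if_neg hcon, ENNReal.mul_top] at hn
    · exact absurd hn not_top_lt
    · exact pow_ne_zero _ (ENNReal.ofReal_pos.2 (Real.exp_pos _)).ne'
  refine ⟨hdT, ?_⟩
  have hsp : 0 < projSpread a b T := hdT.spread_pos
  rw [lyapunov, if_pos hdT, ← ENNReal.ofReal_pow (Real.exp_pos _).le,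
    ← ENNReal.ofReal_mul (by positivity), ENNReal.ofReal_lt_ofReal_iff hη0, hη,
    ← Real.exp_nat_mul, show (n : ℝ) * (s * c) = c * n * s by ring, Real.exp_mul,
    ← Real.mul_rpow (Real.exp_pos _).le (by positivity),
    Real.rpow_lt_rpow_iff (by positivity) (by positivity) hs0] at hn
  set Q := |cross T| / projSpread a b T ^ 2 with hQ
  have hQ0 : 0 ≤ Q := by positivity
  have h1 : 1 ≤ Real.exp (2 / 3 * projBalance a b T) :=
    Real.one_le_exp (mul_nonneg (by norm_num) (balance_nonneg _ _ _))
  have h2 : Real.exp (c * n) * Q ≤ 1 / (|K| + 1) := by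
    refine le_trans ?_ hn.le
    gcongr
    exact le_mul_of_one_le_right hQ0 h1
  rw [le_div_iff₀ (by positivity)] at h2
  rw [neg_mul, Real.exp_neg, ← one_div, le_div_iff₀ (Real.exp_pos _)]
  calc K * Q * Real.exp (c * n) ≤ (|K| + 1) * Q * Real.exp (c * n) := by
        gcongr; linarith [le_abs_self K]
    _ = Real.exp (c * n) * Q * (|K| + 1) := by ring
    _ ≤ 1 := h2

lemma ae_projDistinct
    (hξ_indep : ProbabilityTheory.iIndepFun (fun p : ℕ × Fin 3 => ξ p.1 p.2) μ)
    (hξ_unif : ∀ n i, pdf.IsUniform (ξ n i) (Icc 0 1) μ volume) {T₀ : Tri} {a b : ℝ}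
    (hd : ProjDistinct a b T₀) (n : ℕ) :
    ∀ᵐ ω ∂μ, ProjDistinct a b (triangleSeq T₀ (fun k i => ξ k i ω) n) := by
  obtain ⟨s, -, hs⟩ := exists_lintegral_growth_rpow_le
  have hL0 : lyapunov a b s T₀ ≠ ⊤ := by
    rw [lyapunov, if_pos hd]; exact ENNReal.ofReal_ne_top
  have hne := ne_top_of_le_ne_top
    (ENNReal.mul_ne_top (ENNReal.pow_ne_top ENNReal.ofReal_ne_top) hL0)
    (lintegral_lyapunov_le hξ_indep hξ_unif T₀ a b hs n)
  filter_upwards [ae_lt_top' ((measurable_lyapunov a b s).comp_aemeasurable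
    (aemeasurable_and_indepFun_triangleSeq hξ_indep hξ_unif T₀ n).1) hne] with ω hω
  by_contra hcon
  simp [lyapunov, hcon] at hω

/-- The projected triple is eventually not too unbalanced. -/
lemma ae_eventually_balance_gt
    (hξ_indep : ProbabilityTheory.iIndepFun (fun p : ℕ × Fin 3 => ξ p.1 p.2) μ)
    (hξ_unif : ∀ n i, pdf.IsUniform (ξ n i) (Icc 0 1) μ volume) {T₀ : Tri} {a b : ℝ}
    (hd : ProjDistinct a b T₀) {ε : ℝ} (hε : 0 < ε) :
    ∀ᵐ ω ∂μ, ∀ᶠ n : ℕ in atTop,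
      Real.exp (-ε * n) < projBalance a b (triangleSeq T₀ (fun k i => ξ k i ω) (n + 1)) := by
  have hmS : ∀ n : ℕ, MeasurableSet {T | projBalance a b T ≤ Real.exp (-ε * n)} := fun n =>
    measurableSet_le (measurable_projBalance a b) measurable_const
  have hle : ∀ n : ℕ, μ {ω | projBalance a b (triangleSeq T₀ (fun k i => ξ k i ω) (n + 1)) ≤
      Real.exp (-ε * n)} ≤ ENNReal.ofReal 4 * ENNReal.ofReal (Real.exp (-ε)) ^ n := by
    intro n
    have hnull := (aemeasurable_and_indepFun_triangleSeq hξ_indep hξ_unif T₀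
      (n + 1)).1.nullMeasurableSet_preimage (hmS n)
    have h1 := lintegral_indicator_one₀ hnull
    have h2 := lintegral_triangleSeq_succ hξ_indep hξ_unif T₀ n
      (W := {T | projBalance a b T ≤ Real.exp (-ε * n)}.indicator 1)
      (measurable_one.indicator (hmS n))
    refine (h1.symm.trans h2).le.trans ?_
    refine (lintegral_mono_ae (g := fun _ => ENNReal.ofReal (4 * Real.exp (-ε * n)))
      ?_).trans (le_of_eq ?_)
    · filter_upwards [ae_projDistinct hξ_indep hξ_unif hd n] with ω hω
      refine le_trans (le_of_eq ?_) (nextBalance_le_measure hω (Real.exp_pos _).le)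
      refine lintegral_congr fun t => ?_
      simp only [indicator, mem_ofPred_eq, projBalance, nextBalance, proj_subTriangle]
      rfl
    · rw [lintegral_const, measure_univ, mul_one, ENNReal.ofReal_mul (by norm_num),
        ← ENNReal.ofReal_pow (Real.exp_pos _).le, ← Real.exp_nat_mul, mul_comm (n : ℝ)]
  have hsum : (∑' n : ℕ, μ {ω | projBalance a b (triangleSeq T₀ (fun k i => ξ k i ω) (n + 1)) ≤
      Real.exp (-ε * n)}) ≠ ⊤ := by
    refine ne_top_of_le_ne_top ?_ (ENNReal.tsum_le_tsum hle)
    rw [ENNReal.tsum_mul_left, ENNReal.tsum_geometric]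
    refine ENNReal.mul_ne_top ENNReal.ofReal_ne_top
      (ENNReal.inv_ne_top.2 (tsub_pos_of_lt ?_).ne')
    rw [← ENNReal.ofReal_one]
    exact (ENNReal.ofReal_lt_ofReal_iff one_pos).2 (Real.exp_lt_one_iff.2 (by linarith))
  filter_upwards [ae_eventually_notMem hsum] with ω hω
  filter_upwards [hω] with n hn
  exact not_le.1 hn

lemma ae_tendsto_maxAngle
    (hξ_indep : ProbabilityTheory.iIndepFun (fun p : ℕ × Fin 3 => ξ p.1 p.2) μ)
    (hξ_unif : ∀ n i, pdf.IsUniform (ξ n i) (Icc 0 1) μ volume) {T₀ : Tri} {a b : ℝ}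
    (hd : ProjDistinct a b T₀) :
    ∀ᵐ ω ∂μ, Tendsto (fun n => maxAngle (triangleSeq T₀ (fun k i => ξ k i ω) n)) atTop
      (nhds Real.pi) := by
  filter_upwards [ae_eventually_area_le hξ_indep hξ_unif hd (c := 0.3) (by norm_num) (a ^ 2 + b ^ 2),
    ae_eventually_balance_gt hξ_indep hξ_unif hd (ε := 0.1) (by norm_num)] with ω h1 h2
  rw [← tendsto_add_atTop_iff_nat 1]
  have hexp : Tendsto (fun n : ℕ => Real.exp (-0.2 * n)) atTop (nhds 0) := by
    refine Real.tendsto_exp_atBot.comp ?_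
    exact (tendsto_natCast_atTop_atTop (R := ℝ)).const_mul_atTop_of_neg (by norm_num)
  have hlow : Tendsto (fun n : ℕ => Real.pi - Real.pi / 2 * Real.exp (-0.2 * n)) atTop
      (nhds Real.pi) := by
    simpa using (hexp.const_mul (Real.pi / 2)).const_sub Real.pi
  refine tendsto_of_tendsto_of_tendsto_of_le_of_le' hlow tendsto_const_nhds ?_
    (Eventually.of_forall fun n => maxAngle_le_pi _)
  filter_upwards [(tendsto_add_atTop_nat 1).eventually h1, h2,
    hexp.eventually (gt_mem_nhds one_pos)] with n hn1 hn2 hn3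
  obtain ⟨hdT, hn1⟩ := hn1
  set T := triangleSeq T₀ (fun k i => ξ k i ω) (n + 1)
  have hB : 0 < projBalance a b T := hdT.balance_pos
  have hkey : (a ^ 2 + b ^ 2) * (|cross T| / (projSpread a b T ^ 2 * projBalance a b T)) ≤
      Real.exp (-0.2 * n) := by
    rw [← div_div, ← mul_div_assoc, div_le_iff₀ hB]
    refine hn1.trans ?_
    calc Real.exp (-0.3 * ((n + 1 : ℕ) : ℝ)) ≤ Real.exp (-0.2 * n) * Real.exp (-0.1 * n) := by
          rw [← Real.exp_add]
          push_cast
          exact Real.exp_le_exp.2 (by linarith)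
      _ ≤ _ := by gcongr
  refine le_trans ?_ (pi_sub_le_maxAngle hdT (hkey.trans_lt hn3))
  have := mul_le_mul_of_nonneg_left hkey (by positivity : (0 : ℝ) ≤ Real.pi / 2)
  linarith

end

lemma cross_triangleSeq_ne_zero {T₀ : Tri} (h₀ : cross T₀ ≠ 0) {t : ℕ → Fin 3 → ℝ}
    (ht : ∀ n i, t n i ∈ Ioo (0 : ℝ) 1) (n : ℕ) : cross (triangleSeq T₀ t n) ≠ 0 := by
  induction n with
  | zero => exact h₀
  | succ n ih =>
    change cross (subTriangle (triangleSeq T₀ t n) (t n)) ≠ 0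
    rw [cross_subTriangle]
    exact mul_ne_zero (areaRatio_mem (ht n)).1.ne' ih

lemma rate_bounds : 0.365 < 1 + Real.log 4 / 3 - Real.pi ^ 2 / 9 ∧
    1 + Real.log 4 / 3 - Real.pi ^ 2 / 9 < 0.366 := by
  have h4 : Real.log 4 = 2 * Real.log 2 := by
    rw [show (4 : ℝ) = 2 ^ 2 by norm_num, Real.log_pow]; norm_num
  have h1 := Real.log_two_gt_d9
  have h2 := Real.log_two_lt_d9
  have h3 := Real.pi_gt_d4
  have h5 := Real.pi_lt_d4
  rw [h4]
  constructor <;> nlinarith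

theorem theorem4 {Ω : Type*} [MeasurableSpace Ω] (μ : MeasureTheory.Measure Ω)
    [MeasureTheory.IsProbabilityMeasure μ]
    (ξ : ℕ → Fin 3 → Ω → ℝ)
    (hξ_indep : ProbabilityTheory.iIndepFun (fun p : ℕ × Fin 3 => ξ p.1 p.2) μ)
    (hξ_unif : ∀ n i, MeasureTheory.pdf.IsUniform (ξ n i) (Set.Icc 0 1) μ MeasureTheory.volume)
    (T₀ : RandomTriangle.Tri) (hT₀ : AffineIndependent ℝ T₀)
    (T : ℕ → Ω → RandomTriangle.Tri)
    (hT : ∀ n ω, T n ω = RandomTriangle.triangleSeq T₀ (fun k i => ξ k i ω) n) :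
    (∀ᵐ ω ∂μ, ∀ n, AffineIndependent ℝ (T n ω)) ∧
    (∀ᵐ ω ∂μ, Filter.Tendsto (fun n => RandomTriangle.maxAngle (T n ω)) Filter.atTop
      (nhds Real.pi)) ∧
    (∀ c : ℝ, c < 1 + Real.log 4 / 3 - Real.pi ^ 2 / 9 →
      ∀ᵐ ω ∂μ, ∀ᶠ n : ℕ in Filter.atTop, ∀ i, RandomTriangle.IsLargestSide (T n ω) i →
        RandomTriangle.height (T n ω) i / RandomTriangle.side (T n ω) i
          ≤ Real.exp (-c * n)) ∧
    0.365 < 1 + Real.log 4 / 3 - Real.pi ^ 2 / 9 ∧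
    1 + Real.log 4 / 3 - Real.pi ^ 2 / 9 < 0.366 := by
  obtain rfl : T = fun n ω => RandomTriangle.triangleSeq T₀ (fun k i => ξ k i ω) n :=
    funext fun n => funext fun ω => hT n ω
  have hc₀ := (affineIndependent_iff_cross_ne_zero T₀).1 hT₀
  obtain ⟨a, b, hd⟩ := exists_proj_distinct hc₀
  refine ⟨?_, ae_tendsto_maxAngle hξ_indep hξ_unif hd, fun c hc => ?_, rate_bounds⟩
  · filter_upwards [ae_mem_Ioo_of_isUniform hξ_unif] with ω hω n
    exact (affineIndependent_iff_cross_ne_zero _).2 (cross_triangleSeq_ne_zero hc₀ hω n)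
  · have hc' : c < 0.37 := by linarith [rate_bounds.2]
    filter_upwards [ae_eventually_area_le hξ_indep hξ_unif hd hc' (9 / 4 * (a ^ 2 + b ^ 2))]
      with ω hω
    filter_upwards [hω] with n hn i hi
    exact (height_div_side_le hn.1 hi).trans hn.2
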